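/- Let $A,B$ be quantum systems with Hilbert spaces $\mathbb C^{D_A}$, $\mathbb C^{D_B}$ ($D_A,D_B\ge 1$), and put $D=D_AD_B$ and $D_{A,k}=\binom{D_A+k-1}{k}$. For an ensemble (probability distribution) $\mathcal D$ of unit vectors let $\rho^{(k)}_{\mathcal D}=\mathbb E_{\psi\sim\mathcal D}(|\psi\rangle\langle\psi|)^{\otimes k}$, and let $\rho^{(k)}_{\mathrm{Haar}}$ (respectively $\rho^{(k)}_{\mathrm{Haar},A}$) be this operator for the uniform distribution on the unit sphere of $\mathbb C^{D}$ (respectively $\mathbb C^{D_A}$). An ensemble $\mathcal D$ in $\mathbb C^{D}$ is a $2k$-design with relative error $\epsilon$ if $(1-\epsilon)\rho^{(2k)}_{\mathrm{Haar}}\preceq\rho^{(2k)}_{\mathcal D}\preceq(1+\epsilon)\rho^{(2k)}_{\mathrm{Haar}}$. For a unit vector $|\Psi\rangle\in\mathbb C^{D_A}\otimes\mathbb C^{D_B}$ and an orthonormal basis $\{|z\rangle\}$ of $\mathbb C^{D_B}$, the projected ensemble $\mathcal E(\Psi)$ consists of the normalized post-measurement states $|\psi_z\rangle\propto(I_A\otimes\langle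 z|)|\Psi\rangle$ with probabilities $p_z=\|(I_A\otimes\langle z|)|\Psi\rangle\|^2$, so $\rho^{(k)}_{\mathcal E}(\Psi)=\sum_z p_z(|\psi_z\rangle\langle\psi_z|)^{\otimes k}$. There is a universal constant $C>0$ (independent of $k,D_A,D_B,\epsilon$, of the ensemble and of the basis) such that for all $k,D_A,D_B,\epsilon$, every $2k$-design $\mathcal D$ with relative error $\epsilon$ in $\mathbb C^{D_A}\otimes\mathbb C^{D_B}$ and every fixed orthonormal basis of $\mathbb C^{D_B}$, the function $\Psi\mapsto\|\rho^{(k)}_{\mathcal E}(\Psi)-\rho^{(k)}_{\mathrm{Haar},A}\|_1$ is integrable under $\mathcal D$ and $$\mathbb E_{\Psi\sim\mathcal D}\big\|\rho^{(k)}_{\mathcal E}(\Psi)-\rho^{(k)}_{\mathrm{Haar},A}\big\|_1\le\sqrt{\frac{D_{A,k}}{D_B}+C\Big(\frac{k^2}{D_A}+D_{A,k}\,\epsilon+\sqrt{\frac{k^2}{D_A}\cdot\frac{D_{A,k}}{D_B}}\Big)},$$ $$\mathbb E_{\Psi\sim\mathcal D}\big\|\rho^{(k)}_{\mathcal E}(\Psi)-\rho^{(k)}_{\mathrm{Haar},A}\big\|_1\le\sqrt{\frac{D_A^{\,k}}{k!}\Big(\frac1{D_B}+C\,\epsilon\Big)}+C\,\frac{k}{\sqrt{D_A}}.$$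 In particular $k$ may grow with the system size, as long as $k^2\ll D_A$. -/

import Mathlib

open MeasureTheory
open scoped ComplexOrder

noncomputable section

namespace DeepTherm

/-- The unit sphere of the Hilbert space with orthonormal basis indexed by `ι`: the (normalized)
pure states of a `card ι`-dimensional quantum system, with its Borel sigma-algebra. -/
abbrev PureState (ι : Type*) [Fintype ι] : Type _ :=
  Metric.sphere (0 : EuclideanSpace ℂ ι) 1

/-- The operator `(|ψ⟩⟨ψ|)^{⊗ k}` on the `k`-fold tensor power, as a matrix in the product basis,
whose elements are indexed by `Fin k → ι`. -/
def tensorProj {ι : Type*} [Fintype ι] (k : ℕ) (ψ : EuclideanSpace ℂ ι) :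
    Matrix (Fin k → ι) (Fin k → ι) ℂ :=
  Matrix.of fun i j => ∏ t, ψ (i t) * star (ψ (j t))

/-- The `k`th moment operator `E_{ψ ∼ μ} (|ψ⟩⟨ψ|)^{⊗ k}` of an ensemble of pure states, the
ensemble being given by a measure `μ` on the unit sphere. -/
def moment {ι : Type*} [Fintype ι] (k : ℕ) (μ : Measure (PureState ι)) :
    Matrix (Fin k → ι) (Fin k → ι) ℂ :=
  Matrix.of fun i j => ∫ ψ, tensorProj k (ψ : EuclideanSpace ℂ ι) i j ∂μ

/-- The Haar ensemble: the surface measure of the unit sphere, normalized to total mass one. -/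
def haar (ι : Type*) [Fintype ι] : Measure (PureState ι) :=
  ((volume : Measure (EuclideanSpace ℂ ι)).toSphere Set.univ)⁻¹ •
    (volume : Measure (EuclideanSpace ℂ ι)).toSphere

/-- The ensemble `μ` is a (Haar) `k`-design with relative error `ε`:
`(1 - ε) ρ_Haar ≼ ρ_μ ≼ (1 + ε) ρ_Haar` for the `k`th moment operators, in the Loewner order. -/
def IsDesignRel {ι : Type*} [Fintype ι] (k : ℕ) (ε : ℝ) (μ : Measure (PureState ι)) : Prop :=
  (moment k μ - ((1 - ε : ℝ) : ℂ) • moment k (haar ι)).PosSemidef ∧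
    (((1 + ε : ℝ) : ℂ) • moment k (haar ι) - moment k μ).PosSemidef

/-- The trace norm (Schatten 1-norm) of a matrix: the sum of its singular values. -/
def traceNorm {n : Type*} [Fintype n] [DecidableEq n] (X : Matrix n n ℂ) : ℝ :=
  ∑ i, Real.sqrt ((Matrix.isHermitian_conjTranspose_mul_self X).eigenvalues i)

section Projected

variable {α β : Type*} [Fintype α] [Fintype β]

/-- The unnormalized post-measurement state `(I_A ⊗ ⟨z|) |Ψ⟩` on `A`, where `|z⟩` is the vector
`v` of the system `B`. -/
def condState (v : EuclideanSpace ℂ β) (Ψ : EuclideanSpace ℂ (α × β)) : EuclideanSpace ℂ α :=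
  WithLp.toLp 2 fun a => ∑ c, star (v c) * Ψ (a, c)

/-- The probability `⟨Ψ| (I_A ⊗ |z⟩⟨z|) |Ψ⟩ = ‖(I_A ⊗ ⟨z|) |Ψ⟩‖²` of the outcome `z`. -/
def outcomeProb (v : EuclideanSpace ℂ β) (Ψ : EuclideanSpace ℂ (α × β)) : ℝ :=
  ‖condState v Ψ‖ ^ 2

/-- The normalized post-measurement state on `A` (the zero vector for an outcome of
probability zero, which carries no weight in the projected ensemble). -/
def projState (v : EuclideanSpace ℂ β) (Ψ : EuclideanSpace ℂ (α × β)) : EuclideanSpace ℂ α :=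
  ((‖condState v Ψ‖⁻¹ : ℝ) : ℂ) • condState v Ψ

/-- The `k`th moment operator `∑_z p_z (|ψ_z⟩⟨ψ_z|)^{⊗ k}` of the projected ensemble
`{p_z, |ψ_z⟩}` generated by `Ψ` when `B` is measured in the orthonormal basis `b`. -/
def projMoment (k : ℕ) (b : OrthonormalBasis β ℂ (EuclideanSpace ℂ β))
    (Ψ : EuclideanSpace ℂ (α × β)) : Matrix (Fin k → α) (Fin k → α) ℂ :=
  ∑ z, ((outcomeProb (b z) Ψ : ℝ) : ℂ) • tensorProj k (projState (b z) Ψ)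

end Projected

/-- The dimension `binom (D + k - 1) k` of the symmetric subspace of the `k`-fold tensor power of
a `D`-dimensional space (`D ≥ 1`). -/
def symDim (D k : ℕ) : ℕ := (D + k - 1).choose k

end DeepTherm

end

/-!
Write `φ_z = (I ⊗ ⟨z|) Ψ` for the unnormalized post-measurement states, `p_z = ‖φ_z‖²`, and
`d = symDim DA k`. The moment operator of the projected ensemble is not a polynomial in `Ψ`, because
of the normalization of the states. It is compared with the polynomial operator
`DB ^ (k - 1) • ∑ z, (|φ_z⟩⟨φ_z|)^{⊗ k}`, whose weights are `DB ^ (k - 1) * p_z ^ k` instead of `p_z`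
(`traceNorm_projMoment_sub_le`). This is a small change since `p_z` is concentrated around `1 / DB`
with relative fluctuations of order `1 / √DA`.

* By Cauchy–Schwarz, the average of `∑ z, |p_z - DB ^ (k - 1) * p_z ^ k|` is controlled by moments of
  `p_z` of order at most `2 k - 1` (`integral_sum_abs_sub_le`).
* The polynomial operator is supported on the symmetric subspace, so its trace distance from the
  Haar moment operator is at most `√d` times the Hilbert–Schmidt distance, the square of which is a
  polynomial of degree `2 k` in `Ψ` and in its conjugate: it involves only the overlaps
  `|⟨φ_z|φ_w⟩|^{2k}` and the powers `p_z ^ k` (`integral_traceNorm_sum_tensorProj_sub_le`).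

A `2k`-design with relative error reproduces, up to the factors `1 ± ε`, the Haar average of `|P|²`
for every homogeneous holomorphic polynomial `P` of degree `2 k`
(`IsDesignRel.integral_norm_sq`). Powers of `p_z` are sums of such squares after multiplication by
powers of `‖Ψ‖ = 1`, and `|⟨φ_z|φ_w⟩|^{2k}` is a difference of two such sums of squares
(`IsDesignRel.integral_inner_condState_pow_le`). The Haar averages follow from Wick's formula
(`integral_haar_prod`): the moment operator of the Haar ensemble is a multiple of the sum of all
permutation operators, which is read off from a Gaussian integral in polar coordinates. The formula is
basis independent, so all coordinates of the `φ_z`, for any orthonormal measurement basis, obey it as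
well (`integral_condState_prod`).

The rest is arithmetic with the rising factorials in these averages. Since trace distances of states
are at most `2`, only the regime `k² ≤ DA`, `d ≤ 4 DB`, `ε ≤ 1` matters for the first bound, and the
second bound follows from the first.
-/

namespace DeepTherm

/-! ### Gaussian integration and moments of the Haar ensemble -/

/-- Integration in polar coordinates of a function that is homogeneous of degree `m` along rays,
against the Gaussian weight. -/
theorem integral_homogeneous_mul_exp {E : Type*} [NormedAddCommGroup E] [NormedSpace ℝ E]
    [MeasurableSpace E] [BorelSpace E] [Nontrivial E] [FiniteDimensional ℝ E]
    (μ : Measure E) [μ.IsAddHaarMeasure] (f : E → ℂ) (m : ℕ)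
    (hf : ∀ (r : ℝ) (x : E), 0 < r → f (r • x) = (r : ℂ) ^ m * f x) :
    ∫ x, f x * (Real.exp (-‖x‖ ^ 2) : ℂ) ∂μ =
      (∫ x : Metric.sphere (0 : E) 1, f x ∂μ.toSphere) *
        (∫ r in Set.Ioi (0 : ℝ), r ^ (Module.finrank ℝ E - 1 + m) * Real.exp (-r ^ 2) : ℝ) := by
  set d := Module.finrank ℝ E
  calc
    ∫ x, f x * (Real.exp (-‖x‖ ^ 2) : ℂ) ∂μ
        = ∫ x : ({(0)}ᶜ : Set E), f x * (Real.exp (-‖(x : E)‖ ^ 2) : ℂ) ∂(μ.comap (↑)) := by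
      rw [integral_subtype_comap (measurableSet_singleton _).compl
        fun x => f x * (Real.exp (-‖x‖ ^ 2) : ℂ), restrict_compl_singleton]
    _ = ∫ x : Metric.sphere (0 : E) 1 × Set.Ioi (0 : ℝ),
          f x.1 * (((x.2 : ℝ) ^ m * Real.exp (-(x.2 : ℝ) ^ 2) : ℝ) : ℂ)
            ∂μ.toSphere.prod (.volumeIoiPow (d - 1)) := by
      rw [← μ.measurePreserving_homeomorphUnitSphereProd.integral_comp
        (Homeomorph.measurableEmbedding _)]
      refine integral_congr_ae (Filter.Eventually.of_forall fun x => ?_)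
      have hx : (x : E) ≠ 0 := x.2
      have hn : 0 < ‖(x : E)‖ := norm_pos_iff.2 hx
      have h1 : (x : E) = ‖(x : E)‖ • (‖(x : E)‖⁻¹ • (x : E)) := by
        rw [smul_smul, mul_inv_cancel₀ hn.ne', one_smul]
      have h2 : f x = (‖(x : E)‖ : ℂ) ^ m * f (‖(x : E)‖⁻¹ • (x : E)) := by
        conv_lhs => rw [h1]
        rw [hf _ _ hn]
      simp only [homeomorphUnitSphereProd_apply_fst_coe, homeomorphUnitSphereProd_apply_snd_coe]
      rw [h2]
      push_cast
      ring
    _ = (∫ x : Metric.sphere (0 : E) 1, f x ∂μ.toSphere) *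
          ∫ r : Set.Ioi (0 : ℝ), (((r : ℝ) ^ m * Real.exp (-(r : ℝ) ^ 2) : ℝ) : ℂ)
            ∂Measure.volumeIoiPow (d - 1) :=
      integral_prod_mul (fun x : Metric.sphere (0 : E) 1 => f x)
        (fun r : Set.Ioi (0 : ℝ) => (((r : ℝ) ^ m * Real.exp (-(r : ℝ) ^ 2) : ℝ) : ℂ))
    _ = _ := by
      congr 1
      rw [integral_complex_ofReal]
      congr 1
      simp only [Measure.volumeIoiPow, ENNReal.ofReal]
      rw [integral_withDensity_eq_integral_smul,
        integral_subtype_comap measurableSet_Ioi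
          fun a : ℝ => Real.toNNReal (a ^ (d - 1)) • (a ^ m * Real.exp (-a ^ 2)),
        setIntegral_congr_fun measurableSet_Ioi fun x hx => ?_]
      · simp only [NNReal.smul_def, smul_eq_mul]
        rw [Real.coe_toNNReal _ (pow_nonneg hx.out.le _), pow_add, mul_assoc]
      · exact (measurable_subtype_coe.pow_const _).real_toNNReal

theorem integral_Ioi_pow_mul_exp (n : ℕ) :
    ∫ r in Set.Ioi (0 : ℝ), r ^ (2 * n + 1) * Real.exp (-r ^ 2) = n.factorial / 2 := by
  have h := integral_rpow_mul_exp_neg_rpow (p := 2) (q := 2 * n + 1) (by norm_num)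
    (by have : (0 : ℝ) ≤ n := n.cast_nonneg
        linarith)
  have h2 : ((2 * n + 1 + 1 : ℝ)) / 2 = n + 1 := by ring
  rw [h2, Real.Gamma_nat_eq_factorial] at h
  have h3 : (1 / 2 * (n.factorial : ℝ)) = n.factorial / 2 := by ring
  rw [← h3, ← h]
  refine setIntegral_congr_fun measurableSet_Ioi fun x _ => ?_
  have h4 : x ^ (2 * (n : ℝ) + 1) = x ^ (2 * n + 1) := by
    rw [← Real.rpow_natCast]
    push_cast
    rfl
  have h5 : x ^ (2 : ℝ) = x ^ 2 := by
    rw [← Real.rpow_natCast]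
    norm_num
  simp only [h4, h5]

/-- Moments of a one-dimensional complex Gaussian. -/
theorem integral_complex_gaussian (a b : ℕ) :
    ∫ z : ℂ, z ^ a * star z ^ b * (Real.exp (-‖z‖ ^ 2) : ℂ) =
      if a = b then (Real.pi * a.factorial : ℂ) else 0 := by
  split_ifs with h
  · subst h
    have h := Complex.integral_rpow_mul_exp_neg_rpow (p := 2) (q := 2 * a) (by norm_num)
      (by have : (0 : ℝ) ≤ a := a.cast_nonneg
          linarith)
    have h2 : ((2 * a + 2 : ℝ)) / 2 = a + 1 := by ring
    rw [h2, Real.Gamma_nat_eq_factorial] at h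
    have h3 : (Real.pi * a.factorial : ℂ) = ((2 * Real.pi / 2 * a.factorial : ℝ) : ℂ) := by
      push_cast; ring
    rw [h3, ← h, ← integral_complex_ofReal]
    refine integral_congr_ae (Filter.Eventually.of_forall fun z => ?_)
    have h4 : z ^ a * star z ^ a = ((‖z‖ ^ (2 * (a : ℝ)) : ℝ) : ℂ) := by
      rw [← mul_pow, Complex.star_def, Complex.mul_conj, Complex.normSq_eq_norm_sq,
        Real.rpow_mul (norm_nonneg _)]
      norm_num
    simp only
    rw [h4]
    push_cast
    norm_num
  · -- A rotation `z ↦ w z` multiplies the integral by `w ^ a * conj w ^ b ≠ 1`.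
    set I := ∫ z : ℂ, z ^ a * star z ^ b * (Real.exp (-‖z‖ ^ 2) : ℂ) with hI
    have hrot : ∀ w : Circle, I = ((w : ℂ) ^ a * star (w : ℂ) ^ b) * I := by
      intro w
      have hm := (rotation w).measurePreserving
      have := hm.integral_comp (rotation w).toHomeomorph.measurableEmbedding
        (fun z : ℂ => z ^ a * star z ^ b * (Real.exp (-‖z‖ ^ 2) : ℂ))
      rw [← integral_const_mul, hI, ← this]
      refine integral_congr_ae (Filter.Eventually.of_forall fun z => ?_)
      simp only [rotation_apply, norm_mul, Circle.norm_coe, one_mul, star_mul', mul_pow]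
      ring
    have key : ∃ w : Circle, (w : ℂ) ^ a * star (w : ℂ) ^ b ≠ 1 := by
      refine ⟨Circle.exp 1, fun h1 => h ?_⟩
      have h2 : ((Circle.exp 1 : Circle) : ℂ) ^ a * star ((Circle.exp 1 : Circle) : ℂ) ^ b
          = Complex.exp (((a - b : ℝ)) * Complex.I) := by
        rw [Circle.coe_exp, Complex.star_def, ← Complex.exp_conj, ← Complex.exp_nat_mul,
          ← Complex.exp_nat_mul, ← Complex.exp_add]
        congr 1
        simp
        ring
      rw [h2, Complex.exp_eq_one_iff] at h1
      obtain ⟨n, hn⟩ := h1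
      have h3 : ((a - b : ℝ) : ℂ) = ((n * (2 * Real.pi) : ℝ) : ℂ) := by
        have := mul_right_cancel₀ Complex.I_ne_zero
          (show ((a - b : ℝ) : ℂ) * Complex.I = (n * (2 * Real.pi)) * Complex.I by
            rw [hn]; ring)
        rw [this]; push_cast; ring
      have h4 : (a - b : ℝ) = n * (2 * Real.pi) := by exact_mod_cast h3
      by_cases hn0 : n = 0
      · rw [hn0] at h4
        have : (a : ℝ) = b := by
          have := h4
          simp at this
          linarith
        exact_mod_cast this
      · exfalso
        refine irrational_pi ?_
        refine ⟨((a : ℤ) - b : ℚ) / (2 * n), ?_⟩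
        have : (n : ℝ) ≠ 0 := by exact_mod_cast hn0
        push_cast
        field_simp
        linarith
    obtain ⟨w, hw⟩ := key
    have := hrot w
    by_contra hne
    exact hw (mul_right_cancel₀ hne (by rw [one_mul]; exact this.symm))

/-- The number of permutations of the tensor factors that carry the index tuple `j` to `i`:
the matrix element, in the product basis, of the sum of all permutation operators. -/
def permCount {ι τ : Type*} [DecidableEq ι] [Fintype τ] [DecidableEq τ] (i j : τ → ι) : ℕ :=
  Fintype.card {π : Equiv.Perm τ // i = j ∘ π}

theorem permCount_eq_prod {ι τ : Type*} [Fintype ι] [DecidableEq ι] [Fintype τ] [DecidableEq τ]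
    (i j : τ → ι) :
    permCount i j = ∏ y, if Fintype.card {t // i t = y} = Fintype.card {t // j t = y} then
      (Fintype.card {t // i t = y}).factorial else 0 := by
  unfold permCount
  by_cases h : ∀ y, Fintype.card {t // i t = y} = Fintype.card {t // j t = y}
  · let e : Equiv.Perm τ := Equiv.ofFiberEquiv fun y => Fintype.equivOfCardEq (h y)
    have he : i = j ∘ e := by
      funext t
      exact (Equiv.ofFiberEquiv_map (fun y => Fintype.equivOfCardEq (h y)) t).symm
    simp only [h, if_true]
    rw [← DomMulAct.stabilizer_card j]
    refine Fintype.card_congr (Equiv.subtypeEquiv (Equiv.mulRight e⁻¹) fun π => ?_)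
    constructor
    · intro hπ
      funext t
      have h1 := congrFun hπ (e⁻¹ t)
      have h2 := congrFun he (e⁻¹ t)
      simp at h1 h2 ⊢
      rw [← h1, h2]
    · intro hπ
      funext t
      have h1 := congrFun hπ (e t)
      have h2 := congrFun he t
      simp at h1 h2 ⊢
      rw [h2, h1]
  · push Not at h
    obtain ⟨y, hy⟩ := h
    rw [Finset.prod_eq_zero (Finset.mem_univ y) (by simp [hy]), Fintype.card_eq_zero_iff]
    refine ⟨fun π => hy ?_⟩
    refine Fintype.card_congr (Equiv.subtypeEquiv π.1 fun t => ?_)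
    rw [show i t = j (π.1 t) from congrFun π.2 t]

theorem integral_pi_gaussian {ι τ : Type*} [Fintype ι] [DecidableEq ι] [Fintype τ] [DecidableEq τ]
    (i j : τ → ι) :
    ∫ x : ι → ℂ, (∏ t, x (i t) * star (x (j t))) * (Real.exp (-∑ y, ‖x y‖ ^ 2) : ℂ) =
      Real.pi ^ Fintype.card ι * permCount i j := by
  have h : ∀ x : ι → ℂ, (∏ t, x (i t) * star (x (j t))) * (Real.exp (-∑ y, ‖x y‖ ^ 2) : ℂ) =
      ∏ y, (x y ^ Fintype.card {t // i t = y} * star (x y) ^ Fintype.card {t // j t = y} *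
        (Real.exp (-‖x y‖ ^ 2) : ℂ)) := by
    intro x
    rw [Finset.prod_mul_distrib, Finset.prod_mul_distrib, Finset.prod_mul_distrib,
      ← Finset.sum_neg_distrib, Real.exp_sum, Complex.ofReal_prod]
    congr 2
    · rw [← Finset.prod_fiberwise' Finset.univ i x]
      simp [Fintype.card_subtype]
    · rw [← Finset.prod_fiberwise' Finset.univ j fun y => star (x y)]
      simp [Fintype.card_subtype]
  simp_rw [h]
  rw [integral_fintype_prod_volume_eq_prod
    fun y z => z ^ Fintype.card {t // i t = y} * star z ^ Fintype.card {t // j t = y} *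
        (Real.exp (-‖z‖ ^ 2) : ℂ)]
  simp_rw [integral_complex_gaussian]
  rw [permCount_eq_prod, Nat.cast_prod, ← Finset.card_univ, ← Finset.prod_const,
    ← Finset.prod_mul_distrib]
  refine Finset.prod_congr rfl fun y _ => ?_
  split_ifs <;> simp

theorem finrank_real_euclideanSpace (ι : Type*) [Fintype ι] :
    Module.finrank ℝ (EuclideanSpace ℂ ι) = 2 * Fintype.card ι := by
  rw [finrank_real_of_complex, finrank_euclideanSpace]

/-- The integral of a Gaussian-weighted function over `EuclideanSpace ℂ ι` is, up to a factor that
does not depend on the function, its integral over `ι → ℂ`. -/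
theorem exists_integral_euclideanSpace_eq (ι : Type*) [Fintype ι] :
    ∃ c : ℝ, c ≠ 0 ∧ ∀ f : (ι → ℂ) → ℂ,
      ∫ x : EuclideanSpace ℂ ι, f x.ofLp = c * ∫ x : ι → ℂ, f x := by
  let e := PiLp.continuousLinearEquiv 2 ℝ (fun _ : ι => ℂ)
  let ν : Measure (ι → ℂ) := Measure.map e (volume : Measure (EuclideanSpace ℂ ι))
  have hν : ν.IsAddHaarMeasure := e.isAddHaarMeasure_map _
  have h := Measure.isAddLeftInvariant_eq_smul ν (volume : Measure (ι → ℂ))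
  set c := Measure.addHaarScalarFactor ν (volume : Measure (ι → ℂ))
  refine ⟨c, ?_, fun f => ?_⟩
  · have := Measure.addHaarScalarFactor_pos_of_isAddHaarMeasure ν (volume : Measure (ι → ℂ))
    exact_mod_cast this.ne'
  · have h1 : ∫ x : EuclideanSpace ℂ ι, f x.ofLp = ∫ x, f x ∂ν :=
      (integral_map_equiv e.toHomeomorph.toMeasurableEquiv f).symm
    rw [h1, h, integral_smul_nnreal_measure]
    simp [NNReal.smul_def]

instance isProbabilityMeasure_haar (ι : Type*) [Fintype ι] [Nonempty ι] :
    IsProbabilityMeasure (haar ι) := by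
  constructor
  have h0 : (volume : Measure (EuclideanSpace ℂ ι)).toSphere ≠ 0 := Measure.toSphere_ne_zero _
  simp only [haar, Measure.smul_apply, smul_eq_mul]
  exact ENNReal.inv_mul_cancel (by rwa [Ne, Measure.measure_univ_eq_zero]) (measure_ne_top _ _)

/-- The moments of the Haar ensemble: up to normalization, the moment operator is the sum of all
permutation operators. -/
theorem integral_haar_prod {ι τ : Type*} [Fintype ι] [Nonempty ι] [DecidableEq ι] [Fintype τ]
    [DecidableEq τ] (i j : τ → ι) :
    ∫ ψ : PureState ι, ∏ t, (ψ : EuclideanSpace ℂ ι) (i t) * star ((ψ : EuclideanSpace ℂ ι) (j t))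
        ∂haar ι =
      permCount i j / ((Fintype.card ι).ascFactorial (Fintype.card τ) : ℂ) := by
  obtain ⟨c, hc, hint⟩ := exists_integral_euclideanSpace_eq ι
  set σ := (volume : Measure (EuclideanSpace ℂ ι)).toSphere with hσ
  have hd : 0 < Fintype.card ι := Fintype.card_pos
  -- the polar-coordinates identity for a monomial of degree `card τ'` in `ψ` and in `conj ψ`
  have main : ∀ {τ' : Type _} [Fintype τ'] [DecidableEq τ'] (i j : τ' → ι),
      (∫ ψ : PureState ι, ∏ t, (ψ : EuclideanSpace ℂ ι) (i t) *
        star ((ψ : EuclideanSpace ℂ ι) (j t)) ∂σ) *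
        (((Fintype.card ι - 1 + Fintype.card τ').factorial / 2 : ℝ) : ℂ) =
      c * (Real.pi ^ Fintype.card ι * permCount i j) := by
    intro τ' _ _ i j
    rw [← integral_Ioi_pow_mul_exp, ← integral_pi_gaussian, ← hint]
    have h1 := integral_homogeneous_mul_exp (volume : Measure (EuclideanSpace ℂ ι))
      (fun x => ∏ t, x (i t) * star (x (j t))) (2 * Fintype.card τ') ?_
    · have h2 : Module.finrank ℝ (EuclideanSpace ℂ ι) - 1 + 2 * Fintype.card τ' =
          2 * (Fintype.card ι - 1 + Fintype.card τ') + 1 := by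
        rw [finrank_real_euclideanSpace]
        omega
      rw [h2] at h1
      rw [← h1]
      refine integral_congr_ae (Filter.Eventually.of_forall fun x => ?_)
      simp only [EuclideanSpace.norm_sq_eq]
    · intro r x _
      have : ∀ t, (r • x) (i t) * star ((r • x) (j t)) =
          (r : ℂ) ^ 2 * (x (i t) * star (x (j t))) := by
        intro t
        simp
        ring
      simp only [this]
      rw [Finset.prod_mul_distrib, Finset.prod_const, Finset.card_univ, pow_mul]
  have h1 := main i j
  have h0 := main (τ' := PEmpty) (fun t => t.elim) (fun t => t.elim)
  have hu : permCount (ι := ι) (τ := PEmpty) (fun t => t.elim) (fun t => t.elim) = 1 := by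
    rw [permCount_eq_prod]
    simp
  rw [hu] at h0
  simp only [Finset.univ_eq_empty, Finset.prod_empty, Fintype.card_pempty, add_zero,
    Nat.cast_one, mul_one] at h0
  have hs : (∫ _ψ : PureState ι, (1 : ℂ) ∂σ) = (σ.real Set.univ : ℂ) := by simp
  rw [hs] at h0
  have hσ0 : σ.real Set.univ ≠ 0 := by
    rw [Measure.real, ENNReal.toReal_ne_zero]
    exact ⟨by rw [Ne, Measure.measure_univ_eq_zero]; exact Measure.toSphere_ne_zero _,
      measure_ne_top _ _⟩
  have hfac : ((Fintype.card ι - 1 + Fintype.card τ).factorial : ℂ) =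
      (Fintype.card ι - 1).factorial * ((Fintype.card ι).ascFactorial (Fintype.card τ) : ℂ) := by
    have := Nat.factorial_mul_ascFactorial (Fintype.card ι - 1) (Fintype.card τ)
    rw [Nat.sub_add_cancel hd] at this
    exact_mod_cast this.symm
  have hA : ((Fintype.card ι).ascFactorial (Fintype.card τ) : ℂ) ≠ 0 := by
    obtain ⟨m, hm⟩ := Nat.exists_eq_add_of_lt hd
    rw [hm]
    exact_mod_cast (Nat.ascFactorial_pos _ _).ne'
  have hF : ((Fintype.card ι - 1).factorial : ℂ) ≠ 0 := by exact_mod_cast Nat.factorial_ne_zero _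
  rw [haar, integral_smul_measure, ← hσ, ENNReal.toReal_inv]
  change ((σ.real Set.univ)⁻¹ : ℝ) • _ = _
  push_cast at h1 h0
  rw [hfac] at h1
  rw [eq_div_iff hA, Complex.real_smul, Complex.ofReal_inv]
  have hσc : (σ.real Set.univ : ℂ) ≠ 0 := by exact_mod_cast hσ0
  set J := ∫ ψ : PureState ι, ∏ t, (ψ : EuclideanSpace ℂ ι) (i t) *
        star ((ψ : EuclideanSpace ℂ ι) (j t)) ∂σ
  have h5 : J * ((Fintype.card ι).ascFactorial (Fintype.card τ) : ℂ) =
      σ.real Set.univ * permCount i j := by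
    have : (J * ((Fintype.card ι).ascFactorial (Fintype.card τ) : ℂ)) *
        ((Fintype.card ι - 1).factorial / 2) =
        (σ.real Set.univ * permCount i j) * ((Fintype.card ι - 1).factorial / 2) := by
      linear_combination h1 - (permCount i j : ℂ) * h0
    exact mul_right_cancel₀ (div_ne_zero hF two_ne_zero) this
  rw [mul_assoc, h5, ← mul_assoc, inv_mul_cancel₀ hσc, one_mul]

/-! ### Permutation counts -/

section PermCount

variable {ι τ : Type*} [DecidableEq ι] [Fintype τ] [DecidableEq τ]

theorem permCount_eq_sum (i j : τ → ι) :
    permCount i j = ∑ π : Equiv.Perm τ, if i = j ∘ π then 1 else 0 := by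
  rw [permCount, Fintype.card_subtype, Finset.card_filter]

theorem sum_permCount_left [Fintype ι] (j : τ → ι) :
    ∑ i, permCount i j = (Fintype.card τ).factorial := by
  simp_rw [permCount_eq_sum]
  rw [Finset.sum_comm]
  simp [Fintype.card_perm]

theorem permCount_mul_permCount_le (i j : τ → ι) :
    permCount i j * permCount j i ≤ permCount i j * permCount j j := by
  rcases Nat.eq_zero_or_pos (permCount i j) with h | h
  · simp [h]
  · obtain ⟨σ, hσ⟩ := Fintype.card_pos_iff.1 h
    refine Nat.mul_le_mul_left _ ?_
    refine Fintype.card_le_of_injective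
      (fun π : {π : Equiv.Perm τ // j = i ∘ π} =>
        (⟨σ * π.1, by
          rw [Equiv.Perm.coe_mul, ← Function.comp_assoc, ← hσ]
          exact π.2⟩ : {π : Equiv.Perm τ // j = j ∘ π})) ?_
    intro π π' h
    have := congrArg Subtype.val h
    exact Subtype.ext (mul_left_cancel this)

/-- A permutation of `τ ⊕ τ` that matches index tuples carrying different labels on the two
summands preserves the summands. -/
theorem permCount_sumElim_le {β : Type*} [DecidableEq β] {z w : β} (hzw : w ≠ z)
    (i j : τ → ι) :
    permCount (Sum.elim (fun t => (i t, w)) (fun t => (j t, z)))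
      (Sum.elim (fun t => (j t, w)) (fun t => (i t, z))) ≤ permCount i j * permCount j i := by
  unfold permCount
  rw [← Fintype.card_prod]
  refine Fintype.card_le_of_surjective
    (fun p : {π : Equiv.Perm τ // i = j ∘ π} × {π : Equiv.Perm τ // j = i ∘ π} =>
      ⟨Equiv.Perm.sumCongr p.1.1 p.2.1, ?_⟩) ?_
  · funext s
    rcases s with s | s
    · have := congrFun p.1.2 s
      simpa using this
    · have := congrFun p.2.2 s
      simpa using this
  · rintro ⟨π, hπ⟩
    have hmaps : Set.MapsTo π (Set.range Sum.inl) (Set.range Sum.inl) := by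
      rintro _ ⟨t, rfl⟩
      have := congrFun hπ (Sum.inl t)
      rcases hs : π (Sum.inl t) with s | s
      · exact ⟨s, rfl⟩
      · simp [hs, hzw] at this
    obtain ⟨⟨σ, ρ⟩, hσρ⟩ := Equiv.Perm.mem_sumCongrHom_range_of_perm_mapsTo_inl hmaps
    have hσρ' : Equiv.Perm.sumCongr σ ρ = π := hσρ
    refine ⟨⟨⟨σ, ?_⟩, ⟨ρ, ?_⟩⟩, Subtype.ext hσρ'⟩
    · funext t
      have := congrFun hπ (Sum.inl t)
      rw [← hσρ'] at this
      simpa using this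
    · funext t
      have := congrFun hπ (Sum.inr t)
      rw [← hσρ'] at this
      simpa using this

/-- The sum of all permutation operators acts on a symmetric product vector as the scalar `n!`. -/
theorem sum_permCount_mul_prod [Fintype ι] (i : τ → ι) (f : ι → ℂ) :
    ∑ j, (permCount i j : ℂ) * ∏ t, f (j t) = (Fintype.card τ).factorial * ∏ t, f (i t) := by
  simp_rw [permCount_eq_sum, Nat.cast_sum, Finset.sum_mul]
  rw [Finset.sum_comm]
  have : ∀ π : Equiv.Perm τ, ∑ j : τ → ι, ((if i = j ∘ π then 1 else 0 : ℕ) : ℂ) *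
      ∏ t, f (j t) = ∏ t, f (i t) := by
    intro π
    rw [Finset.sum_eq_single (i ∘ π.symm)]
    · have : i = (i ∘ π.symm) ∘ π := by funext t; simp
      rw [if_pos this, Nat.cast_one, one_mul]
      exact Equiv.prod_comp π.symm fun t => f (i t)
    · intro j _ hj
      rw [if_neg, Nat.cast_zero, zero_mul]
      rintro rfl
      exact hj (by funext t; simp)
    · simp
  rw [Finset.sum_congr rfl fun π _ => this π]
  simp [Fintype.card_perm]

end PermCount

/-! ### Haar averages of polynomials in the post-measurement states -/

theorem integrable_of_continuous {ι : Type*} [Fintype ι] {μ : Measure (PureState ι)}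
    [IsFiniteMeasure μ] {F : Type*} [NormedAddCommGroup F]
    {f : PureState ι → F} (hf : Continuous f) : Integrable f μ :=
  hf.integrable_of_hasCompactSupport (HasCompactSupport.of_compactSpace f)

theorem prod_sum_mul {ι τ : Type*} [Fintype ι] [Fintype τ] [DecidableEq τ]
    (u : τ → ι → ℂ) (ψ : ι → ℂ) :
    ∏ t, ∑ x, u t x * ψ x = ∑ i : τ → ι, (∏ t, u t (i t)) * ∏ t, ψ (i t) := by
  rw [Finset.prod_univ_sum, Fintype.piFinset_univ]
  simp_rw [Finset.prod_mul_distrib]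

/-- Wick's formula for the Haar ensemble: the average of a product of linear forms and conjugates of
linear forms is a sum over all complete pairings. -/
theorem integral_haar_prod_linear {ι τ : Type*} [Fintype ι] [Nonempty ι] [DecidableEq ι]
    [Fintype τ] [DecidableEq τ] (u v : τ → ι → ℂ) :
    ∫ ψ : PureState ι, ∏ t, (∑ x, u t x * (ψ : EuclideanSpace ℂ ι) x) *
        star (∑ x, v t x * (ψ : EuclideanSpace ℂ ι) x) ∂haar ι =
      (∑ π : Equiv.Perm τ, ∏ t, ∑ x, u t x * star (v (π t) x)) /
        ((Fintype.card ι).ascFactorial (Fintype.card τ) : ℂ) := by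
  have h1 : ∀ ψ : PureState ι, ∏ t, (∑ x, u t x * (ψ : EuclideanSpace ℂ ι) x) *
        star (∑ x, v t x * (ψ : EuclideanSpace ℂ ι) x) =
      ∑ i : τ → ι, ∑ j : τ → ι, ((∏ t, u t (i t)) * ∏ t, star (v t (j t))) *
        ∏ t, (ψ : EuclideanSpace ℂ ι) (i t) * star ((ψ : EuclideanSpace ℂ ι) (j t)) := by
    intro ψ
    rw [Finset.prod_mul_distrib, prod_sum_mul]
    have : ∏ t, star (∑ x, v t x * (ψ : EuclideanSpace ℂ ι) x) =
        ∑ j : τ → ι, (∏ t, star (v t (j t))) * ∏ t, star ((ψ : EuclideanSpace ℂ ι) (j t)) := by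
      rw [← prod_sum_mul (fun t x => star (v t x)) fun x => star ((ψ : EuclideanSpace ℂ ι) x)]
      simp only [star_sum, star_mul']
    rw [this, Finset.sum_mul_sum]
    refine Finset.sum_congr rfl fun i _ => Finset.sum_congr rfl fun j _ => ?_
    rw [Finset.prod_mul_distrib]
    ring
  have hint : ∀ i j : τ → ι, Integrable (fun ψ : PureState ι =>
      ((∏ t, u t (i t)) * ∏ t, star (v t (j t))) *
        ∏ t, (ψ : EuclideanSpace ℂ ι) (i t) * star ((ψ : EuclideanSpace ℂ ι) (j t))) (haar ι) :=
    fun i j => integrable_of_continuous (by fun_prop)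
  simp_rw [h1]
  rw [integral_finsetSum _ fun i _ => integrable_finsetSum _ fun j _ => hint i j]
  simp_rw [integral_finsetSum _ fun j _ => hint _ j, integral_const_mul, integral_haar_prod]
  simp_rw [← mul_div_assoc, ← Finset.sum_div]
  congr 1
  simp_rw [permCount_eq_sum, Nat.cast_sum, Finset.mul_sum]
  have h2 : ∀ i : τ → ι, ∑ j : τ → ι, ∑ π : Equiv.Perm τ,
      ((∏ t, u t (i t)) * ∏ t, star (v t (j t))) * ((if i = j ∘ π then 1 else 0 : ℕ) : ℂ) =
      ∑ π : Equiv.Perm τ, ∏ t, u t (i t) * star (v (π t) (i t)) := by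
    intro i
    rw [Finset.sum_comm]
    refine Finset.sum_congr rfl fun π _ => ?_
    rw [Finset.sum_eq_single (i ∘ π.symm)]
    · have : i = (i ∘ π.symm) ∘ π := by funext t; simp
      rw [if_pos this, Nat.cast_one, mul_one, Finset.prod_mul_distrib]
      congr 1
      rw [← Equiv.prod_comp π fun t => star (v t ((i ∘ π.symm) t))]
      simp
    · intro j _ hj
      rw [if_neg, Nat.cast_zero, mul_zero]
      rintro rfl
      exact hj (by funext t; simp)
    · simp
  simp_rw [h2]
  rw [Finset.sum_comm]
  refine Finset.sum_congr rfl fun π _ => ?_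
  rw [Finset.prod_univ_sum, Fintype.piFinset_univ]

/-- The squared norm of a power of a vector, expanded over index tuples. -/
theorem norm_pow_eq_sum {ι : Type*} [Fintype ι] (φ : EuclideanSpace ℂ ι) (m : ℕ) :
    ((‖φ‖ ^ (2 * m) : ℝ) : ℂ) = ∑ i : Fin m → ι, ∏ t, φ (i t) * star (φ (i t)) := by
  rw [pow_mul, EuclideanSpace.norm_sq_eq, Complex.ofReal_pow, Complex.ofReal_sum,
    ← Fintype.sum_pow fun a => φ a * star (φ a)]
  congr 1
  refine Finset.sum_congr rfl fun a _ => ?_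
  rw [Complex.star_def, Complex.mul_conj, Complex.normSq_eq_norm_sq]

theorem ascFactorial_ne_zero {d : ℕ} (hd : 0 < d) (m : ℕ) : d.ascFactorial m ≠ 0 := by
  obtain ⟨n, rfl⟩ := Nat.exists_eq_succ_of_ne_zero hd.ne'
  exact (Nat.ascFactorial_pos _ _).ne'

/-- The trace of the sum of all permutation operators. -/
theorem sum_permCount_self (ι : Type*) [Fintype ι] [Nonempty ι] [DecidableEq ι] (m : ℕ) :
    ∑ i : Fin m → ι, permCount i i = (Fintype.card ι).ascFactorial m := by
  have h : ∀ ψ : PureState ι, ∑ i : Fin m → ι, ∏ t, (ψ : EuclideanSpace ℂ ι) (i t) *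
      star ((ψ : EuclideanSpace ℂ ι) (i t)) = 1 := by
    intro ψ
    rw [← norm_pow_eq_sum, norm_eq_of_mem_sphere]
    simp
  have h2 : ∫ ψ : PureState ι, ∑ i : Fin m → ι, ∏ t, (ψ : EuclideanSpace ℂ ι) (i t) *
      star ((ψ : EuclideanSpace ℂ ι) (i t)) ∂haar ι = 1 := by
    simp_rw [h]
    simp
  rw [integral_finsetSum _ fun i _ => integrable_of_continuous (by fun_prop)] at h2
  simp_rw [integral_haar_prod, ← Finset.sum_div] at h2
  have h3 : ((Fintype.card ι).ascFactorial (Fintype.card (Fin m)) : ℂ) ≠ 0 := by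
    exact_mod_cast ascFactorial_ne_zero Fintype.card_pos _
  rw [div_eq_one_iff_eq h3, Fintype.card_fin] at h2
  exact_mod_cast h2

section Projected

variable {α β : Type*} [Fintype α] [Fintype β]

/-- The coordinates of the post-measurement states in all outcomes together form a vector that is
distributed like the coordinates of `Ψ` itself, so they obey the same moment formula. -/
theorem integral_condState_prod [DecidableEq α] [DecidableEq β]
    [Nonempty α] [Nonempty β] {τ : Type*} [Fintype τ] [DecidableEq τ]
    (b : OrthonormalBasis β ℂ (EuclideanSpace ℂ β)) (i j : τ → α × β) :
    ∫ Ψ : PureState (α × β), ∏ t, condState (b (i t).2) (Ψ : EuclideanSpace ℂ (α × β)) (i t).1 *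
        star (condState (b (j t).2) (Ψ : EuclideanSpace ℂ (α × β)) (j t).1) ∂haar (α × β) =
      permCount i j / ((Fintype.card α * Fintype.card β).ascFactorial (Fintype.card τ) : ℂ) := by
  let u : α × β → α × β → ℂ := fun p x => if p.1 = x.1 then star (b p.2 x.2) else 0
  have h1 : ∀ (p : α × β) (Ψ : EuclideanSpace ℂ (α × β)),
      condState (b p.2) Ψ p.1 = ∑ x, u p x * Ψ x := by
    intro p Ψ
    simp [condState, u, Fintype.sum_prod_type]
  have h2 : ∀ p q : α × β, ∑ x, u p x * star (u q x) = if p = q then 1 else 0 := by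
    intro p q
    have hb : ∑ c, star (b p.2 c) * b q.2 c = if p.2 = q.2 then 1 else 0 := by
      have := orthonormal_iff_ite.1 b.orthonormal p.2 q.2
      rw [← this, PiLp.inner_apply]
      simp [mul_comm]
    rcases p with ⟨a, z⟩
    rcases q with ⟨a', z'⟩
    simp only at hb
    by_cases ha : a = a'
    · subst ha
      simp only [u, Fintype.sum_prod_type]
      rw [Finset.sum_eq_single a (by
        intro x _ hx
        simp [hx.symm]) (by simp)]
      simp only [if_true, star_star, hb, Prod.mk.injEq, true_and]
    · have : ∀ x : α × β, u (a, z) x * star (u (a', z') x) = 0 := by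
        intro x
        simp only [u]
        split_ifs with h h' <;> first | exact absurd (h.trans h'.symm) ha | simp
      simp only [this, Finset.sum_const_zero, Prod.mk.injEq, ha, false_and, if_false]
  simp_rw [h1]
  rw [integral_haar_prod_linear (fun t => u (i t)) (fun t => u (j t)), Fintype.card_prod]
  congr 1
  rw [permCount_eq_sum, Nat.cast_sum]
  refine Finset.sum_congr rfl fun π _ => ?_
  simp_rw [h2]
  rw [Finset.prod_ite_zero]
  simp [funext_iff]

@[fun_prop]
theorem continuous_condState_sphere (v : EuclideanSpace ℂ β) :
    Continuous fun Ψ : PureState (α × β) => condState v (Ψ : EuclideanSpace ℂ (α × β)) := by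
  unfold condState
  fun_prop

/-- Moments of the outcome probabilities in the Haar ensemble. -/
theorem integral_norm_condState_pow [Nonempty α] [Nonempty β]
    (b : OrthonormalBasis β ℂ (EuclideanSpace ℂ β)) (z : β)
    (m : ℕ) :
    ∫ Ψ : PureState (α × β), ‖condState (b z) (Ψ : EuclideanSpace ℂ (α × β))‖ ^ (2 * m)
        ∂haar (α × β) =
      ((Fintype.card α).ascFactorial m : ℝ) /
        ((Fintype.card α * Fintype.card β).ascFactorial m : ℝ) := by
  classical
  apply Complex.ofReal_injective
  rw [← integral_complex_ofReal]
  simp_rw [norm_pow_eq_sum]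
  rw [integral_finsetSum _ fun i _ => integrable_of_continuous (by fun_prop)]
  have h := fun i : Fin m → α => integral_condState_prod b (fun t => (i t, z)) (fun t => (i t, z))
  simp only at h
  simp_rw [h]
  have h2 : ∀ i : Fin m → α,
      permCount (fun t => (i t, z)) (fun t => (i t, z)) = permCount i i := by
    intro i
    unfold permCount
    refine Fintype.card_congr (Equiv.subtypeEquivRight fun π => ?_)
    simp [funext_iff]
  simp_rw [h2]
  rw [← Finset.sum_div, ← Nat.cast_sum, sum_permCount_self, Fintype.card_fin]
  push_cast
  rfl

/-- Post-measurement states of two different outcomes have, on average over the Haar ensemble, the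
overlap of two independent random states. -/
theorem integral_inner_condState_pow_le [Nonempty α] [Nonempty β]
    (b : OrthonormalBasis β ℂ (EuclideanSpace ℂ β)) {z w : β}
    (hzw : z ≠ w) (k : ℕ) :
    ∫ Ψ : PureState (α × β), ‖inner ℂ (condState (b z) (Ψ : EuclideanSpace ℂ (α × β)))
        (condState (b w) (Ψ : EuclideanSpace ℂ (α × β)))‖ ^ (2 * k) ∂haar (α × β) ≤
      (k.factorial * (Fintype.card α).ascFactorial k : ℝ) /
        ((Fintype.card α * Fintype.card β).ascFactorial (2 * k) : ℝ) := by
  classical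
  have hexp : ∀ φ χ : EuclideanSpace ℂ α, ((‖inner ℂ φ χ‖ ^ (2 * k) : ℝ) : ℂ) =
      ∑ i : Fin k → α, ∑ j : Fin k → α,
        ∏ t, χ (i t) * star (φ (i t)) * (φ (j t) * star (χ (j t))) := by
    intro φ χ
    have h0 : inner ℂ φ χ = ∑ a, χ a * star (φ a) := by
      rw [PiLp.inner_apply]
      simp
    have h1 : ((‖inner ℂ φ χ‖ ^ (2 * k) : ℝ) : ℂ) = (inner ℂ φ χ) ^ k * star (inner ℂ φ χ) ^ k := by
      rw [← mul_pow, Complex.star_def, Complex.mul_conj, Complex.normSq_eq_norm_sq, pow_mul]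
      push_cast
      rfl
    have h2 : star (∑ a, χ a * star (φ a)) = ∑ a, φ a * star (χ a) := by
      simp [mul_comm]
    rw [h1, h0, h2, Fintype.sum_pow, Fintype.sum_pow, Finset.sum_mul_sum]
    refine Finset.sum_congr rfl fun i _ => Finset.sum_congr rfl fun j _ => ?_
    rw [← Finset.prod_mul_distrib]
  have hval : ∫ Ψ : PureState (α × β), ‖inner ℂ (condState (b z) (Ψ : EuclideanSpace ℂ (α × β)))
        (condState (b w) (Ψ : EuclideanSpace ℂ (α × β)))‖ ^ (2 * k) ∂haar (α × β) =
      ((∑ i : Fin k → α, ∑ j : Fin k → α,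
        permCount (Sum.elim (fun t => (i t, w)) (fun t => (j t, z)))
          (Sum.elim (fun t => (j t, w)) (fun t => (i t, z))) : ℕ) : ℝ) /
        ((Fintype.card α * Fintype.card β).ascFactorial (2 * k) : ℝ) := by
    apply Complex.ofReal_injective
    rw [← integral_complex_ofReal]
    simp_rw [hexp]
    rw [integral_finsetSum _ fun i _ => integrable_of_continuous (by fun_prop)]
    have h : ∀ i j : Fin k → α, ∫ Ψ : PureState (α × β),
        ∏ t, condState (b w) (Ψ : EuclideanSpace ℂ (α × β)) (i t) *
          star (condState (b z) (Ψ : EuclideanSpace ℂ (α × β)) (i t)) *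
          (condState (b z) (Ψ : EuclideanSpace ℂ (α × β)) (j t) *
          star (condState (b w) (Ψ : EuclideanSpace ℂ (α × β)) (j t))) ∂haar (α × β) =
        (permCount (Sum.elim (fun t => (i t, w)) (fun t => (j t, z)))
          (Sum.elim (fun t => (j t, w)) (fun t => (i t, z))) : ℂ) /
        ((Fintype.card α * Fintype.card β).ascFactorial (2 * k) : ℂ) := by
      intro i j
      have := integral_condState_prod b
        (Sum.elim (fun t => (i t, w)) (fun t => (j t, z)) : Fin k ⊕ Fin k → α × β)
        (Sum.elim (fun t => (j t, w)) (fun t => (i t, z)))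
      simp only [Fintype.prod_sum_type, Sum.elim_inl, Sum.elim_inr, Fintype.card_sum,
        Fintype.card_fin] at this
      rw [two_mul, ← this]
      refine integral_congr_ae (Filter.Eventually.of_forall fun Ψ => ?_)
      simp only
      rw [← Finset.prod_mul_distrib]
      refine Finset.prod_congr rfl fun t _ => ?_
      ring
    have h' : ∀ i : Fin k → α, ∫ Ψ : PureState (α × β), ∑ j : Fin k → α,
        ∏ t, condState (b w) (Ψ : EuclideanSpace ℂ (α × β)) (i t) *
          star (condState (b z) (Ψ : EuclideanSpace ℂ (α × β)) (i t)) *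
          (condState (b z) (Ψ : EuclideanSpace ℂ (α × β)) (j t) *
          star (condState (b w) (Ψ : EuclideanSpace ℂ (α × β)) (j t))) ∂haar (α × β) =
        ∑ j : Fin k → α, (permCount (Sum.elim (fun t => (i t, w)) (fun t => (j t, z)))
          (Sum.elim (fun t => (j t, w)) (fun t => (i t, z))) : ℂ) /
        ((Fintype.card α * Fintype.card β).ascFactorial (2 * k) : ℂ) := by
      intro i
      rw [integral_finsetSum _ fun j _ => integrable_of_continuous (by fun_prop)]
      simp_rw [h]
    simp_rw [h', ← Finset.sum_div]
    push_cast
    rfl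
  rw [hval]
  refine div_le_div_of_nonneg_right ?_ (Nat.cast_nonneg _)
  norm_cast
  calc ∑ i : Fin k → α, ∑ j : Fin k → α,
        permCount (Sum.elim (fun t => (i t, w)) (fun t => (j t, z)))
          (Sum.elim (fun t => (j t, w)) (fun t => (i t, z)))
      ≤ ∑ i : Fin k → α, ∑ j : Fin k → α, permCount i j * permCount j j :=
        Finset.sum_le_sum fun i _ => Finset.sum_le_sum fun j _ =>
          (permCount_sumElim_le hzw.symm i j).trans (permCount_mul_permCount_le i j)
    _ = k.factorial * (Fintype.card α).ascFactorial k := by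
        rw [Finset.sum_comm]
        simp_rw [← Finset.sum_mul, sum_permCount_left, ← Finset.mul_sum]
        rw [sum_permCount_self, Fintype.card_fin]

end Projected

/-! ### The moment operator of the Haar ensemble -/

theorem symDim_mul_factorial (D k : ℕ) : k.factorial * symDim D k = D.ascFactorial k := by
  rw [symDim, Nat.ascFactorial_eq_factorial_mul_choose']

theorem symDim_pos {D : ℕ} (hD : 0 < D) (k : ℕ) : 0 < symDim D k :=
  Nat.choose_pos (by omega)

theorem moment_haar_apply {ι : Type*} [Fintype ι] [Nonempty ι] [DecidableEq ι] {k : ℕ}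
    (i j : Fin k → ι) :
    moment k (haar ι) i j = permCount i j / ((Fintype.card ι).ascFactorial k : ℂ) := by
  have := integral_haar_prod i j
  rw [Fintype.card_fin] at this
  exact this

/-- The Haar moment operator acts on symmetric product vectors as the inverse of the dimension of
the symmetric subspace. -/
theorem sum_moment_haar_mul_prod {ι : Type*} [Fintype ι] [Nonempty ι] {k : ℕ}
    (i : Fin k → ι) (φ : ι → ℂ) :
    ∑ j, moment k (haar ι) i j * ∏ t, φ (j t) =
      (symDim (Fintype.card ι) k : ℂ)⁻¹ * ∏ t, φ (i t) := by
  classical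
  simp_rw [moment_haar_apply, div_mul_eq_mul_div]
  rw [← Finset.sum_div, sum_permCount_mul_prod, Fintype.card_fin, ← symDim_mul_factorial,
    Nat.cast_mul]
  have h1 : (k.factorial : ℂ) ≠ 0 := by exact_mod_cast k.factorial_ne_zero
  have h2 : (symDim (Fintype.card ι) k : ℂ) ≠ 0 := by
    exact_mod_cast (symDim_pos Fintype.card_pos k).ne'
  field_simp

/-! ### Comparing a design with the Haar ensemble on squares of polynomials -/

section Design

variable {ι : Type*} [Fintype ι]

/-- Homogeneous polynomials of degree `n` in the coordinates of a vector (not in their conjugates),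
given by a not necessarily symmetric coefficient tensor. -/
def IsHomPoly (n : ℕ) (P : EuclideanSpace ℂ ι → ℂ) : Prop :=
  ∃ c : (Fin n → ι) → ℂ, ∀ Ψ, P Ψ = ∑ i, c i * ∏ t, Ψ (i t)

theorem isHomPoly_prod {τ : Type*} [Fintype τ] {n : ℕ} (hτ : Fintype.card τ = n)
    (u : τ → ι → ℂ) : IsHomPoly n fun Ψ => ∏ t, ∑ x, u t x * Ψ x := by
  classical
  let e : Fin n ≃ τ := (Fintype.equivFinOfCardEq hτ).symm
  refine ⟨fun i => ∏ t, u (e t) (i t), fun Ψ => ?_⟩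
  rw [← prod_sum_mul (fun t => u (e t)) fun x => Ψ x]
  exact (Equiv.prod_comp e fun t => ∑ x, u t x * Ψ x).symm

theorem IsHomPoly.add_mul {n : ℕ} {P Q : EuclideanSpace ℂ ι → ℂ} (hP : IsHomPoly n P)
    (hQ : IsHomPoly n Q) (s : ℂ) : IsHomPoly n fun Ψ => P Ψ + s * Q Ψ := by
  obtain ⟨c, hc⟩ := hP
  obtain ⟨d, hd⟩ := hQ
  refine ⟨fun i => c i + s * d i, fun Ψ => ?_⟩
  simp only [hc, hd, Finset.mul_sum]
  rw [← Finset.sum_add_distrib]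
  refine Finset.sum_congr rfl fun i _ => ?_
  ring

theorem IsHomPoly.continuous {n : ℕ} {P : EuclideanSpace ℂ ι → ℂ} (hP : IsHomPoly n P) :
    Continuous fun ψ : PureState ι => P ψ := by
  obtain ⟨c, hc⟩ := hP
  simp_rw [hc]
  fun_prop

theorem integral_norm_sq_eq_moment {n : ℕ} {P : EuclideanSpace ℂ ι → ℂ}
    {c : (Fin n → ι) → ℂ} (hc : ∀ Ψ, P Ψ = ∑ i, c i * ∏ t, Ψ (i t))
    (μ : Measure (PureState ι)) [IsFiniteMeasure μ] :
    ((∫ ψ : PureState ι, ‖P ψ‖ ^ 2 ∂μ : ℝ) : ℂ) =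
      ∑ i, ∑ j, c i * moment n μ i j * star (c j) := by
  rw [← integral_complex_ofReal]
  have h : ∀ ψ : PureState ι, ((‖P ψ‖ ^ 2 : ℝ) : ℂ) =
      ∑ i, ∑ j, c i * tensorProj n (ψ : EuclideanSpace ℂ ι) i j * star (c j) := by
    intro ψ
    rw [← Complex.normSq_eq_norm_sq, ← Complex.mul_conj, ← Complex.star_def, hc, star_sum,
      Finset.sum_mul_sum]
    refine Finset.sum_congr rfl fun i _ => Finset.sum_congr rfl fun j _ => ?_
    simp only [tensorProj, Matrix.of_apply, Finset.prod_mul_distrib, star_mul', star_prod]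
    ring
  simp_rw [h]
  have hcont : ∀ i j : Fin n → ι, Continuous fun ψ : PureState ι =>
      c i * tensorProj n (ψ : EuclideanSpace ℂ ι) i j * star (c j) := by
    intro i j
    simp only [tensorProj, Matrix.of_apply]
    fun_prop
  rw [integral_finsetSum _ fun i _ => integrable_finsetSum _ fun j _ =>
    integrable_of_continuous (hcont i j)]
  refine Finset.sum_congr rfl fun i _ => ?_
  rw [integral_finsetSum _ fun j _ => integrable_of_continuous (hcont i j)]
  refine Finset.sum_congr rfl fun j _ => ?_
  rw [integral_mul_const, integral_const_mul]
  rfl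

theorem sum_mul_mul_star_nonneg {n : Type*} [Fintype n] {M : Matrix n n ℂ} (hM : M.PosSemidef)
    (c : n → ℂ) : 0 ≤ ∑ i, ∑ j, c i * M i j * star (c j) := by
  have := hM.dotProduct_mulVec_nonneg (star c)
  simpa [dotProduct, Matrix.mulVec, Finset.mul_sum, mul_assoc] using this

variable [Nonempty ι] {n : ℕ} {ε : ℝ} {μ : Measure (PureState ι)} [IsFiniteMeasure μ]

theorem IsDesignRel.integral_norm_sq (h : IsDesignRel n ε μ) {P : EuclideanSpace ℂ ι → ℂ}
    (hP : IsHomPoly n P) :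
    (1 - ε) * ∫ ψ : PureState ι, ‖P ψ‖ ^ 2 ∂haar ι ≤ ∫ ψ : PureState ι, ‖P ψ‖ ^ 2 ∂μ ∧
      ∫ ψ : PureState ι, ‖P ψ‖ ^ 2 ∂μ ≤ (1 + ε) * ∫ ψ : PureState ι, ‖P ψ‖ ^ 2 ∂haar ι := by
  obtain ⟨c, hc⟩ := hP
  have h1 := sum_mul_mul_star_nonneg h.1 c
  have h2 := sum_mul_mul_star_nonneg h.2 c
  have hμ := integral_norm_sq_eq_moment hc μ
  have hH := integral_norm_sq_eq_moment hc (haar ι)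
  simp only [Matrix.sub_apply, Matrix.smul_apply, smul_eq_mul, mul_sub, sub_mul,
    Finset.sum_sub_distrib] at h1 h2
  have hsm : ∀ s : ℂ, ∑ i, ∑ j, c i * (s * moment n (haar ι) i j) * star (c j) =
      s * ∑ i, ∑ j, c i * moment n (haar ι) i j * star (c j) := by
    intro s
    rw [Finset.mul_sum]
    refine Finset.sum_congr rfl fun i _ => ?_
    rw [Finset.mul_sum]
    refine Finset.sum_congr rfl fun j _ => ?_
    ring
  rw [hsm, ← hμ, ← hH, ← Complex.ofReal_mul, ← Complex.ofReal_sub, Complex.zero_le_real,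
    sub_nonneg] at h1 h2
  exact ⟨h1, h2⟩

theorem IsDesignRel.integral_sum_norm_sq (h : IsDesignRel n ε μ) {κ : Type*} [Fintype κ]
    {P : κ → EuclideanSpace ℂ ι → ℂ} (hP : ∀ s, IsHomPoly n (P s)) {f : PureState ι → ℝ}
    (hf : ∀ ψ : PureState ι, f ψ = ∑ s, ‖P s ψ‖ ^ 2) :
    (1 - ε) * ∫ ψ, f ψ ∂haar ι ≤ ∫ ψ, f ψ ∂μ ∧
      ∫ ψ, f ψ ∂μ ≤ (1 + ε) * ∫ ψ, f ψ ∂haar ι := by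
  simp_rw [hf]
  have hc : ∀ s, Continuous fun ψ : PureState ι => ‖P s ψ‖ ^ 2 := fun s =>
    (hP s).continuous.norm.pow 2
  rw [integral_finsetSum _ fun s _ => integrable_of_continuous (hc s),
    integral_finsetSum _ fun s _ => integrable_of_continuous (hc s), Finset.mul_sum, Finset.mul_sum]
  exact ⟨Finset.sum_le_sum fun s _ => (h.integral_norm_sq (hP s)).1,
    Finset.sum_le_sum fun s _ => (h.integral_norm_sq (hP s)).2⟩

end Design

theorem norm_pow_eq_sum_norm_sq {ι : Type*} [Fintype ι] (φ : EuclideanSpace ℂ ι) (m : ℕ) :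
    ‖φ‖ ^ (2 * m) = ∑ i : Fin m → ι, ‖∏ t, φ (i t)‖ ^ 2 := by
  rw [pow_mul, EuclideanSpace.norm_sq_eq, Fintype.sum_pow]
  simp_rw [norm_prod, Finset.prod_pow]

/-- The squared norms of `u ⊗ v - v ⊗ u` and `u ⊗ v + v ⊗ u`, for `s = -1` and `s = 1`. -/
theorem sum_norm_add_mul_sq {κ : Type*} [Fintype κ] (u v : κ → ℂ) {s : ℝ} (hs : s ^ 2 = 1) :
    ∑ p : κ × κ, ‖u p.1 * v p.2 + s * (v p.1 * u p.2)‖ ^ 2 =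
      2 * ((∑ i, ‖u i‖ ^ 2) * ∑ i, ‖v i‖ ^ 2) + 2 * s * ‖∑ i, v i * star (u i)‖ ^ 2 := by
  apply Complex.ofReal_injective
  have hn : ∀ x : ℂ, ((‖x‖ ^ 2 : ℝ) : ℂ) = x * star x := fun x => by
    rw [Complex.star_def, Complex.mul_conj, Complex.normSq_eq_norm_sq]
  have hs' : (s : ℂ) ^ 2 = 1 := by exact_mod_cast hs
  have hss : star (s : ℂ) = s := by simp
  simp only [Complex.ofReal_add, Complex.ofReal_mul, Complex.ofReal_sum, hn]
  have h1 : ∀ p : κ × κ, (u p.1 * v p.2 + s * (v p.1 * u p.2)) *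
      star (u p.1 * v p.2 + s * (v p.1 * u p.2)) =
      (u p.1 * star (u p.1)) * (v p.2 * star (v p.2)) +
      (v p.1 * star (v p.1)) * (u p.2 * star (u p.2)) +
      s * ((v p.1 * star (u p.1)) * (u p.2 * star (v p.2)) +
        (u p.1 * star (v p.1)) * (v p.2 * star (u p.2))) := by
    intro p
    simp only [star_add, star_mul', hss]
    linear_combination (v p.1 * star (v p.1)) * (u p.2 * star (u p.2)) * hs'
  simp_rw [h1]
  have h2 : star (∑ i, v i * star (u i)) = ∑ i, u i * star (v i) := by
    simp [mul_comm]
  rw [Finset.sum_add_distrib, Finset.sum_add_distrib, ← Finset.mul_sum, Finset.sum_add_distrib, h2]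
  simp only [Fintype.sum_prod_type, ← Finset.sum_mul_sum, Complex.ofReal_ofNat]
  ring

section Projected

variable {α β : Type*} [Fintype α] [Fintype β]

/-- A coordinate of a post-measurement state is a linear form of the total state. -/
theorem exists_linear_condState (v : EuclideanSpace ℂ β) (a : α) :
    ∃ u : α × β → ℂ, ∀ Ψ : EuclideanSpace ℂ (α × β), condState v Ψ a = ∑ x, u x * Ψ x := by
  classical
  refine ⟨fun x => if a = x.1 then star (v x.2) else 0, fun Ψ => ?_⟩
  simp [condState, Fintype.sum_prod_type]

variable [Nonempty α] [Nonempty β] {n : ℕ} {ε : ℝ} {μ : Measure (PureState (α × β))}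
  [IsFiniteMeasure μ]

/-- Moments of outcome probabilities of order `m ≤ n` in an `n`-design. Multiplying by a power of
`‖Ψ‖ = 1` raises the degree from `m` to `n`. -/
theorem IsDesignRel.integral_norm_condState_pow (h : IsDesignRel n ε μ)
    (b : OrthonormalBasis β ℂ (EuclideanSpace ℂ β)) (z : β) {m : ℕ} (hm : m ≤ n) :
    (1 - ε) * (((Fintype.card α).ascFactorial m : ℝ) /
        ((Fintype.card α * Fintype.card β).ascFactorial m : ℝ)) ≤
      ∫ Ψ : PureState (α × β), ‖condState (b z) (Ψ : EuclideanSpace ℂ (α × β))‖ ^ (2 * m) ∂μ ∧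
    ∫ Ψ : PureState (α × β), ‖condState (b z) (Ψ : EuclideanSpace ℂ (α × β))‖ ^ (2 * m) ∂μ ≤
      (1 + ε) * (((Fintype.card α).ascFactorial m : ℝ) /
        ((Fintype.card α * Fintype.card β).ascFactorial m : ℝ)) := by
  rw [← DeepTherm.integral_norm_condState_pow b z m]
  choose u hu using exists_linear_condState (α := α) (b z)
  classical
  have hx : ∀ (x : α × β) (Ψ : EuclideanSpace ℂ (α × β)),
      Ψ x = ∑ y, (if y = x then 1 else 0) * Ψ y := by
    intro x Ψ
    simp
  refine h.integral_sum_norm_sq (κ := (Fin m → α) × (Fin (n - m) → α × β))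
    (P := fun p Ψ => (∏ t, condState (b z) Ψ (p.1 t)) * ∏ t, Ψ (p.2 t)) (fun p => ?_) fun Ψ => ?_
  · have := isHomPoly_prod (τ := Fin m ⊕ Fin (n - m)) (n := n) (by simp [hm])
      (Sum.elim (fun t => u (p.1 t)) (fun t y => if y = p.2 t then 1 else 0))
    simp only [Fintype.prod_sum_type, Sum.elim_inl, Sum.elim_inr, ← hu, ← hx] at this
    exact this
  · simp_rw [norm_mul, mul_pow]
    rw [Fintype.sum_prod_type]
    simp only
    rw [← Finset.sum_mul_sum, ← norm_pow_eq_sum_norm_sq, ← norm_pow_eq_sum_norm_sq,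
      norm_eq_of_mem_sphere]
    simp

theorem IsDesignRel.nonneg {ι : Type*} [Fintype ι] [Nonempty ι] {μ : Measure (PureState ι)}
    [IsFiniteMeasure μ] (h : IsDesignRel n ε μ) : 0 ≤ ε := by
  classical
  have := h.integral_sum_norm_sq (κ := Fin n → ι) (P := fun p Ψ => ∏ t, Ψ (p t)) (f := fun _ => 1)
    (fun p => ?_) fun Ψ => ?_
  · have h1 := this.1.trans this.2
    simp at h1
    linarith
  · have := isHomPoly_prod (τ := Fin n) (n := n) (by simp)
      (fun t (y : ι) => if y = p t then 1 else 0)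
    simpa using this
  · rw [← norm_pow_eq_sum_norm_sq, norm_eq_of_mem_sphere]
    simp

/-- The overlap `|⟨φ|χ⟩|^{2k}` is not itself a sum of squares, but its sum with and its difference
from `‖φ‖^{2k} ‖χ‖^{2k}` are, being up to a factor the squared norms of the symmetric and
antisymmetric parts of `φ^{⊗k} ⊗ χ^{⊗k}`. -/
theorem IsDesignRel.integral_inner_condState_pow_le {k : ℕ} (h : IsDesignRel (2 * k) ε μ)
    (b : OrthonormalBasis β ℂ (EuclideanSpace ℂ β)) (z w : β) :
    ∫ Ψ : PureState (α × β), ‖inner ℂ (condState (b z) (Ψ : EuclideanSpace ℂ (α × β)))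
        (condState (b w) (Ψ : EuclideanSpace ℂ (α × β)))‖ ^ (2 * k) ∂μ ≤
      ∫ Ψ : PureState (α × β), ‖inner ℂ (condState (b z) (Ψ : EuclideanSpace ℂ (α × β)))
        (condState (b w) (Ψ : EuclideanSpace ℂ (α × β)))‖ ^ (2 * k) ∂haar (α × β) +
      ε * ∫ Ψ : PureState (α × β), ‖condState (b z) (Ψ : EuclideanSpace ℂ (α × β))‖ ^ (2 * k) *
        ‖condState (b w) (Ψ : EuclideanSpace ℂ (α × β))‖ ^ (2 * k) ∂haar (α × β) := by
  choose u hu using fun z => exists_linear_condState (α := α) (b z)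
  set G : PureState (α × β) → ℝ := fun Ψ =>
    ‖condState (b z) (Ψ : EuclideanSpace ℂ (α × β))‖ ^ (2 * k) *
        ‖condState (b w) (Ψ : EuclideanSpace ℂ (α × β))‖ ^ (2 * k)
  set F : PureState (α × β) → ℝ := fun Ψ =>
    ‖inner ℂ (condState (b z) (Ψ : EuclideanSpace ℂ (α × β)))
        (condState (b w) (Ψ : EuclideanSpace ℂ (α × β)))‖ ^ (2 * k)
  have hF : Continuous F := by fun_prop
  have hG : Continuous G := by fun_prop
  have key : ∀ s : ℝ, s ^ 2 = 1 →
      (1 - ε) * ∫ Ψ, (2 * G Ψ + 2 * s * F Ψ) ∂haar (α × β) ≤ ∫ Ψ, (2 * G Ψ + 2 * s * F Ψ) ∂μ ∧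
      ∫ Ψ, (2 * G Ψ + 2 * s * F Ψ) ∂μ ≤
        (1 + ε) * ∫ Ψ, (2 * G Ψ + 2 * s * F Ψ) ∂haar (α × β) := by
    intro s hs
    refine h.integral_sum_norm_sq (κ := (Fin k → α) × (Fin k → α))
      (P := fun p Ψ => (∏ t, condState (b z) Ψ (p.1 t)) * (∏ t, condState (b w) Ψ (p.2 t)) +
        s * ((∏ t, condState (b w) Ψ (p.1 t)) * (∏ t, condState (b z) Ψ (p.2 t))))
      (fun p => ?_) fun Ψ => ?_
    · have hp : ∀ z w : β, IsHomPoly (2 * k) fun Ψ : EuclideanSpace ℂ (α × β) =>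
          (∏ t, condState (b z) Ψ (p.1 t)) * (∏ t, condState (b w) Ψ (p.2 t)) := by
        intro z w
        have := isHomPoly_prod (τ := Fin k ⊕ Fin k) (n := 2 * k) (by simp [two_mul])
          (Sum.elim (fun t => u z (p.1 t)) (fun t => u w (p.2 t)))
        simp only [Fintype.prod_sum_type, Sum.elim_inl, Sum.elim_inr, ← hu] at this
        exact this
      exact (hp z w).add_mul (hp w z) s
    · have h1 := sum_norm_add_mul_sq
        (fun i : Fin k → α => ∏ t, condState (b z) (Ψ : EuclideanSpace ℂ (α × β)) (i t))
        (fun i => ∏ t, condState (b w) (Ψ : EuclideanSpace ℂ (α × β)) (i t)) hs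
      rw [h1, ← norm_pow_eq_sum_norm_sq, ← norm_pow_eq_sum_norm_sq]
      have h2 : ∑ i : Fin k → α, (∏ t, condState (b w) (Ψ : EuclideanSpace ℂ (α × β)) (i t)) *
          star (∏ t, condState (b z) (Ψ : EuclideanSpace ℂ (α × β)) (i t)) =
          (inner ℂ (condState (b z) (Ψ : EuclideanSpace ℂ (α × β)))
            (condState (b w) (Ψ : EuclideanSpace ℂ (α × β)))) ^ k := by
        rw [PiLp.inner_apply, Fintype.sum_pow]
        refine Finset.sum_congr rfl fun i _ => ?_
        rw [star_prod, ← Finset.prod_mul_distrib]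
        simp
      rw [h2, norm_pow, ← pow_mul, mul_comm k 2]
  have hint : ∀ (ν : Measure (PureState (α × β))) [IsFiniteMeasure ν] (s : ℝ),
      ∫ Ψ, (2 * G Ψ + 2 * s * F Ψ) ∂ν = 2 * ∫ Ψ, G Ψ ∂ν + 2 * s * ∫ Ψ, F Ψ ∂ν := by
    intro ν _ s
    rw [integral_add (integrable_of_continuous (by fun_prop))
      (integrable_of_continuous (by fun_prop)), integral_const_mul, integral_const_mul]
  have h1 := (key 1 (by norm_num)).2
  have h2 := (key (-1) (by norm_num)).1
  simp only [hint] at h1 h2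
  nlinarith

end Projected

/-! ### Duality for the trace norm -/

section TraceNorm

variable {n : Type*} [Fintype n]

/-- Matrices of operator norm at most one. -/
def IsContraction [DecidableEq n] (W : Matrix n n ℂ) : Prop :=
  (1 - W * W.conjTranspose).PosSemidef

theorem mul_conjTranspose_apply_self {m : Type*} (A : Matrix m n ℂ) (i : m) :
    (A * A.conjTranspose) i i = ((∑ j, ‖A i j‖ ^ 2 : ℝ) : ℂ) := by
  rw [Matrix.mul_apply, Complex.ofReal_sum]
  refine Finset.sum_congr rfl fun j _ => ?_
  rw [Matrix.conjTranspose_apply, Complex.star_def, Complex.mul_conj, Complex.normSq_eq_norm_sq]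

theorem norm_sum_mul_le (a b : n → ℂ) :
    ‖∑ i, a i * b i‖ ≤ Real.sqrt (∑ i, ‖a i‖ ^ 2) * Real.sqrt (∑ i, ‖b i‖ ^ 2) := by
  refine (norm_sum_le _ _).trans ?_
  simp_rw [norm_mul]
  exact Real.sum_mul_le_sqrt_mul_sqrt _ _ _

theorem norm_trace_mul_le (A B : Matrix n n ℂ) :
    ‖(A * B).trace‖ ≤
      Real.sqrt (∑ i, ∑ j, ‖A i j‖ ^ 2) * Real.sqrt (∑ i, ∑ j, ‖B i j‖ ^ 2) := by
  have h : (A * B).trace = ∑ p : n × n, A p.1 p.2 * B p.2 p.1 := by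
    simp [Matrix.trace, Matrix.mul_apply, Fintype.sum_prod_type]
  have := norm_sum_mul_le (fun p : n × n => A p.1 p.2) (fun p : n × n => B p.2 p.1)
  rw [h]
  refine this.trans_eq ?_
  rw [Fintype.sum_prod_type, Fintype.sum_prod_type_right]

variable [DecidableEq n]

theorem IsContraction.sum_norm_sq_le {W : Matrix n n ℂ} (hW : IsContraction W)
    (A : Matrix n n ℂ) (i : n) : ∑ j, ‖(A * W) i j‖ ^ 2 ≤ ∑ j, ‖A i j‖ ^ 2 := by
  have h := (hW.mul_mul_conjTranspose_same A).diag_nonneg (i := i)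
  have h2 : A * (1 - W * W.conjTranspose) * A.conjTranspose =
      A * A.conjTranspose - (A * W) * (A * W).conjTranspose := by
    rw [Matrix.conjTranspose_mul]
    noncomm_ring
  rw [h2, Matrix.sub_apply, mul_conjTranspose_apply_self, mul_conjTranspose_apply_self,
    ← Complex.ofReal_sub, Complex.zero_le_real, sub_nonneg] at h
  exact h

theorem IsContraction.norm_apply_le {W : Matrix n n ℂ} (hW : IsContraction W) (i j : n) :
    ‖W i j‖ ≤ 1 := by
  have h := hW.sum_norm_sq_le 1 i
  rw [one_mul] at h
  have h1 : ∑ j, ‖(1 : Matrix n n ℂ) i j‖ ^ 2 = 1 := by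
    rw [Finset.sum_eq_single i] <;> simp +contextual [eq_comm]
  have h2 : ‖W i j‖ ^ 2 ≤ ∑ j, ‖W i j‖ ^ 2 :=
    Finset.single_le_sum (f := fun j => ‖W i j‖ ^ 2) (fun _ _ => by positivity)
      (Finset.mem_univ j)
  have h3 : ‖W i j‖ ^ 2 ≤ 1 := by linarith
  exact (sq_le_one_iff₀ (norm_nonneg _)).1 h3

theorem eigenvalues_conjTranspose_mul_self_nonneg (X : Matrix n n ℂ) (i : n) :
    0 ≤ (Matrix.isHermitian_conjTranspose_mul_self X).eigenvalues i :=
  (Matrix.posSemidef_conjTranspose_mul_self X).eigenvalues_nonneg i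

/-- The eigenvector matrix of `Xᴴ X` diagonalizes it. -/
theorem exists_unitary_diagonal (X : Matrix n n ℂ) :
    ∃ V : Matrix n n ℂ, V.conjTranspose * V = 1 ∧ V * V.conjTranspose = 1 ∧
      X.conjTranspose * X = V * Matrix.diagonal (fun i =>
        ((Matrix.isHermitian_conjTranspose_mul_self X).eigenvalues i : ℂ)) * V.conjTranspose := by
  have hH := Matrix.isHermitian_conjTranspose_mul_self X
  refine ⟨hH.eigenvectorUnitary, ?_, ?_, ?_⟩
  · exact Unitary.coe_star_mul_self hH.eigenvectorUnitary
  · exact Unitary.coe_mul_star_self hH.eigenvectorUnitary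
  · conv_lhs => rw [hH.spectral_theorem]
    rfl

/-- Polar decomposition: the trace norm is attained by pairing with a contraction. -/
theorem exists_isContraction_trace_eq (X : Matrix n n ℂ) :
    ∃ W : Matrix n n ℂ, IsContraction W ∧ (W * X).trace = (traceNorm X : ℂ) := by
  obtain ⟨V, hV1, hV2, hX⟩ := exists_unitary_diagonal X
  set l := (Matrix.isHermitian_conjTranspose_mul_self X).eigenvalues with hl
  have hl0 : ∀ i, 0 ≤ l i := eigenvalues_conjTranspose_mul_self_nonneg X
  -- on the kernel of `X` the inverse square root takes the junk value zero, as it should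
  let S : Matrix n n ℂ := Matrix.diagonal fun i => (((Real.sqrt (l i))⁻¹ : ℝ) : ℂ)
  have hS : S.conjTranspose = S := by
    simp [S, Matrix.diagonal_conjTranspose, Pi.star_def]
  have hWX : V * S * V.conjTranspose * X.conjTranspose * X =
      V * Matrix.diagonal (fun i => (Real.sqrt (l i) : ℂ)) * V.conjTranspose := by
    have h1 : V * S * V.conjTranspose * X.conjTranspose * X =
        V * S * (V.conjTranspose * V) * Matrix.diagonal (fun i => (l i : ℂ)) *
          V.conjTranspose := by
      rw [Matrix.mul_assoc _ X.conjTranspose, hX]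
      simp only [Matrix.mul_assoc]
    rw [h1, hV1, Matrix.mul_one, Matrix.mul_assoc V, Matrix.diagonal_mul_diagonal]
    congr 3
    funext i
    rw [← Complex.ofReal_mul]
    congr 1
    rcases (hl0 i).eq_or_lt with h | h
    · simp [← h]
    · have h2 : Real.sqrt (l i) ≠ 0 := (Real.sqrt_pos.2 h).ne'
      field_simp
      exact (Real.sq_sqrt h.le).symm
  refine ⟨V * S * V.conjTranspose * X.conjTranspose, ?_, ?_⟩
  · unfold IsContraction
    have h1 : 1 - V * S * V.conjTranspose * X.conjTranspose *
        (V * S * V.conjTranspose * X.conjTranspose).conjTranspose =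
        V * Matrix.diagonal (fun i => ((1 - Real.sqrt (l i) * (Real.sqrt (l i))⁻¹ : ℝ) : ℂ)) *
          V.conjTranspose := by
      have h2 : V * S * V.conjTranspose * X.conjTranspose *
          (V * S * V.conjTranspose * X.conjTranspose).conjTranspose =
          V * Matrix.diagonal (fun i => (Real.sqrt (l i) : ℂ)) * (V.conjTranspose * V) * S *
            V.conjTranspose := by
        simp only [Matrix.conjTranspose_mul, Matrix.conjTranspose_conjTranspose, hS]
        rw [← Matrix.mul_assoc, hWX]
        simp only [Matrix.mul_assoc]
      have h3 : Matrix.diagonal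
          (fun i => ((1 - Real.sqrt (l i) * (Real.sqrt (l i))⁻¹ : ℝ) : ℂ)) =
          1 - Matrix.diagonal (fun i => (Real.sqrt (l i) : ℂ)) * S := by
        rw [Matrix.diagonal_mul_diagonal, ← Matrix.diagonal_one, Matrix.diagonal_sub]
        congr 1
        funext i
        push_cast
        rfl
      rw [h2, hV1, h3, Matrix.mul_one, Matrix.mul_sub, Matrix.sub_mul, Matrix.mul_one, hV2]
      simp only [Matrix.mul_assoc]
    rw [h1]
    refine Matrix.PosSemidef.mul_mul_conjTranspose_same (Matrix.PosSemidef.diagonal fun i => ?_) V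
    simp only [Pi.zero_apply, Complex.zero_le_real, sub_nonneg]
    exact mul_inv_le_one
  · rw [hWX, Matrix.trace_mul_comm, ← Matrix.mul_assoc, hV1, Matrix.one_mul, Matrix.trace_diagonal,
      traceNorm, Complex.ofReal_sum]

/-- Pairing with a contraction is bounded by the trace norm. -/
theorem IsContraction.norm_trace_mul_le {W : Matrix n n ℂ} (hW : IsContraction W)
    (Y : Matrix n n ℂ) : ‖(W * Y).trace‖ ≤ traceNorm Y := by
  obtain ⟨V, hV1, hV2, hY⟩ := exists_unitary_diagonal Y
  set l := (Matrix.isHermitian_conjTranspose_mul_self Y).eigenvalues with hl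
  have h1 : (W * Y).trace = ((V.conjTranspose * W) * (Y * V)).trace := by
    rw [Matrix.mul_assoc, Matrix.trace_mul_comm V.conjTranspose, Matrix.mul_assoc W,
      Matrix.mul_assoc Y, hV2, Matrix.mul_one]
  rw [h1, Matrix.trace]
  refine (norm_sum_le _ _).trans (Finset.sum_le_sum fun i _ => ?_)
  rw [Matrix.diag_apply, Matrix.mul_apply]
  refine (norm_sum_mul_le _ _).trans ?_
  have h2 : ∑ j, ‖(V.conjTranspose * W) i j‖ ^ 2 ≤ 1 := by
    refine (hW.sum_norm_sq_le V.conjTranspose i).trans ?_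
    have h3 := mul_conjTranspose_apply_self V.conjTranspose i
    rw [Matrix.conjTranspose_conjTranspose, hV1, Matrix.one_apply_eq] at h3
    have h4 : ∑ j, ‖V.conjTranspose i j‖ ^ 2 = 1 := by exact_mod_cast h3.symm
    rw [h4]
  have h3 : ∑ j, ‖(Y * V) j i‖ ^ 2 = l i := by
    have h4 := mul_conjTranspose_apply_self (Y * V).conjTranspose i
    have h5 : (Y * V).conjTranspose * (Y * V) = (V.conjTranspose * V) * Matrix.diagonal (fun i => (l i : ℂ)) *
        (V.conjTranspose * V) := by
      rw [Matrix.conjTranspose_mul, Matrix.mul_assoc, ← Matrix.mul_assoc Y.conjTranspose, hY]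
      simp only [Matrix.mul_assoc]
    rw [Matrix.conjTranspose_conjTranspose, h5, hV1, Matrix.one_mul, Matrix.mul_one,
      Matrix.diagonal_apply_eq] at h4
    have h6 := Complex.ofReal_injective h4
    rw [h6]
    refine Finset.sum_congr rfl fun j _ => ?_
    rw [Matrix.conjTranspose_apply, norm_star]
  rw [h3]
  calc _ ≤ 1 * _ := mul_le_mul_of_nonneg_right (Real.sqrt_le_one.2 h2) (Real.sqrt_nonneg _)
    _ = _ := one_mul _

theorem traceNorm_nonneg (X : Matrix n n ℂ) : 0 ≤ traceNorm X :=
  Finset.sum_nonneg fun _ _ => Real.sqrt_nonneg _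

theorem traceNorm_le_of_forall {X : Matrix n n ℂ} {c : ℝ}
    (h : ∀ W : Matrix n n ℂ, IsContraction W → ‖(W * X).trace‖ ≤ c) : traceNorm X ≤ c := by
  obtain ⟨W, hW, hX⟩ := exists_isContraction_trace_eq X
  have := h W hW
  rwa [hX, Complex.norm_real, Real.norm_of_nonneg (traceNorm_nonneg X)] at this

theorem traceNorm_add_le (X Y : Matrix n n ℂ) :
    traceNorm (X + Y) ≤ traceNorm X + traceNorm Y := by
  refine traceNorm_le_of_forall fun W hW => ?_
  rw [Matrix.mul_add, Matrix.trace_add]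
  exact (norm_add_le _ _).trans (add_le_add (hW.norm_trace_mul_le X) (hW.norm_trace_mul_le Y))

theorem traceNorm_neg (X : Matrix n n ℂ) : traceNorm (-X) = traceNorm X := by
  have h : ∀ X : Matrix n n ℂ, traceNorm (-X) ≤ traceNorm X := fun X =>
    traceNorm_le_of_forall fun W hW => by
      rw [Matrix.mul_neg, Matrix.trace_neg, norm_neg]
      exact hW.norm_trace_mul_le X
  refine (h X).antisymm ?_
  have := h (-X)
  rwa [neg_neg] at this

theorem traceNorm_sum_smul_vecMulVec_le {κ : Type*} [Fintype κ] (c : κ → ℝ) (v : κ → n → ℂ) :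
    traceNorm (∑ s, (c s : ℂ) • Matrix.vecMulVec (v s) (star (v s))) ≤
      ∑ s, |c s| * ∑ i, ‖v s i‖ ^ 2 := by
  refine traceNorm_le_of_forall fun W hW => ?_
  rw [Matrix.mul_sum, Matrix.trace_sum]
  refine (norm_sum_le _ _).trans (Finset.sum_le_sum fun s _ => ?_)
  rw [Matrix.mul_smul, Matrix.trace_smul, norm_smul, Complex.norm_real, Real.norm_eq_abs]
  refine mul_le_mul_of_nonneg_left ?_ (abs_nonneg _)
  rw [Matrix.trace_mul_comm, Matrix.vecMulVec_mul, Matrix.trace_vecMulVec, dotProduct]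
  refine (norm_sum_mul_le _ _).trans ?_
  have h1 : ∑ j, ‖(Matrix.vecMul (star (v s)) W) j‖ ^ 2 ≤ ∑ i, ‖v s i‖ ^ 2 := by
    rcases isEmpty_or_nonempty n with hn | ⟨⟨i₀⟩⟩
    · simp
    · have := hW.sum_norm_sq_le (Matrix.of fun _ j => star (v s j)) i₀
      simpa [Matrix.mul_apply, Matrix.vecMul, dotProduct] using this
  calc _ ≤ Real.sqrt (∑ i, ‖v s i‖ ^ 2) * Real.sqrt (∑ i, ‖v s i‖ ^ 2) :=
        mul_le_mul_of_nonneg_left (Real.sqrt_le_sqrt h1) (Real.sqrt_nonneg _)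
    _ = _ := Real.mul_self_sqrt (Finset.sum_nonneg fun _ _ => by positivity)

/-- On matrices supported in the range of a projection `P`, the trace norm is at most the square
root of the rank of `P` times the Hilbert-Schmidt norm. -/
theorem traceNorm_le_of_mul_eq {Y P : Matrix n n ℂ} (h : Y * P = Y) :
    traceNorm Y ≤ Real.sqrt (∑ i, ∑ j, ‖P i j‖ ^ 2) * Real.sqrt (∑ i, ∑ j, ‖Y i j‖ ^ 2) := by
  refine traceNorm_le_of_forall fun W hW => ?_
  have h1 : (W * Y).trace = ((P * W) * Y).trace := by
    rw [Matrix.mul_assoc, Matrix.trace_mul_comm P, Matrix.mul_assoc, h]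
  rw [h1]
  refine (DeepTherm.norm_trace_mul_le _ _).trans ?_
  refine mul_le_mul_of_nonneg_right (Real.sqrt_le_sqrt ?_) (Real.sqrt_nonneg _)
  exact Finset.sum_le_sum fun i _ => hW.sum_norm_sq_le P i

theorem continuous_traceNorm : Continuous (traceNorm : Matrix n n ℂ → ℝ) := by
  have h1 : ∀ X Y : Matrix n n ℂ, traceNorm X - traceNorm Y ≤ ∑ i, ∑ j, ‖X i j - Y i j‖ := by
    intro X Y
    have h2 : traceNorm (X - Y) ≤ ∑ i, ∑ j, ‖X i j - Y i j‖ := by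
      refine traceNorm_le_of_forall fun W hW => ?_
      rw [Matrix.trace_mul_comm, Matrix.trace]
      refine (norm_sum_le _ _).trans (Finset.sum_le_sum fun i _ => ?_)
      rw [Matrix.diag_apply, Matrix.mul_apply]
      refine (norm_sum_le _ _).trans (Finset.sum_le_sum fun j _ => ?_)
      rw [norm_mul, Matrix.sub_apply]
      exact mul_le_of_le_one_right (norm_nonneg _) (hW.norm_apply_le j i)
    have h3 := traceNorm_add_le (X - Y) Y
    rw [sub_add_cancel] at h3
    linarith
  rw [continuous_iff_continuousAt]
  intro Y
  rw [ContinuousAt, tendsto_iff_dist_tendsto_zero]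
  have hg : Filter.Tendsto (fun X : Matrix n n ℂ => ∑ i, ∑ j, ‖X i j - Y i j‖) (nhds Y)
      (nhds 0) := by
    have hc : Continuous fun X : Matrix n n ℂ => ∑ i, ∑ j, ‖X i j - Y i j‖ := by fun_prop
    have := hc.tendsto Y
    simpa using this
  refine squeeze_zero (fun _ => dist_nonneg) (fun X => ?_) hg
  rw [Real.dist_eq, abs_le]
  have h2 := h1 Y X
  simp_rw [fun i j => norm_sub_rev (Y i j) (X i j)] at h2
  exact ⟨by linarith, h1 X Y⟩

end TraceNorm

/-! ### The projected ensemble and its polynomial approximation -/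

section Operators

variable {ι : Type*} [Fintype ι] {k : ℕ}

theorem tensorProj_eq_vecMulVec (φ : EuclideanSpace ℂ ι) :
    tensorProj k φ = Matrix.vecMulVec (fun i => ∏ t, φ (i t)) (star fun i => ∏ t, φ (i t)) := by
  ext i j
  simp [tensorProj, Matrix.vecMulVec_apply, Finset.prod_mul_distrib]

theorem conjTranspose_tensorProj (φ : EuclideanSpace ℂ ι) :
    (tensorProj k φ).conjTranspose = tensorProj k φ := by
  rw [tensorProj_eq_vecMulVec, Matrix.conjTranspose_vecMulVec, star_star]

theorem trace_tensorProj (φ : EuclideanSpace ℂ ι) :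
    (tensorProj k φ).trace = ((‖φ‖ ^ (2 * k) : ℝ) : ℂ) := by
  rw [norm_pow_eq_sum]
  rfl

theorem trace_tensorProj_mul (φ χ : EuclideanSpace ℂ ι) :
    (tensorProj k φ * tensorProj k χ).trace = ((‖inner ℂ φ χ‖ ^ (2 * k) : ℝ) : ℂ) := by
  have h : ∀ φ χ : EuclideanSpace ℂ ι, (star fun i : Fin k → ι => ∏ t, φ (i t)) ⬝ᵥ
      (fun i : Fin k → ι => ∏ t, χ (i t)) = inner ℂ φ χ ^ k := by
    intro φ χ
    rw [PiLp.inner_apply, Fintype.sum_pow, dotProduct]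
    refine Finset.sum_congr rfl fun i _ => ?_
    simp [Finset.prod_mul_distrib, mul_comm]
  rw [tensorProj_eq_vecMulVec, tensorProj_eq_vecMulVec, Matrix.vecMulVec_mul_vecMulVec, h,
    Matrix.vecMulVec_smul, Matrix.trace_smul, Matrix.trace_vecMulVec, dotProduct_comm, h, smul_eq_mul, ← mul_pow,
    ← inner_conj_symm χ φ, Complex.mul_conj, Complex.normSq_eq_norm_sq, pow_mul]
  push_cast
  rfl

theorem tensorProj_real_smul (r : ℝ) (φ : EuclideanSpace ℂ ι) :
    tensorProj k ((r : ℂ) • φ) = ((r ^ (2 * k) : ℝ) : ℂ) • tensorProj k φ := by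
  ext i j
  have h : ∀ t, (r : ℂ) * φ (i t) * star ((r : ℂ) * φ (j t)) =
      (r : ℂ) ^ 2 * (φ (i t) * star (φ (j t))) := by
    intro t
    simp
    ring
  simp only [tensorProj, Matrix.of_apply, Matrix.smul_apply, PiLp.smul_apply, smul_eq_mul, h]
  rw [Finset.prod_mul_distrib, Finset.prod_const, Finset.card_univ, Fintype.card_fin, ← pow_mul]
  push_cast
  rfl

theorem conjTranspose_moment_haar :
    (moment k (haar ι)).conjTranspose = moment k (haar ι) := by
  ext i j
  rw [Matrix.conjTranspose_apply]
  simp only [moment, Matrix.of_apply]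
  rw [Complex.star_def, ← integral_conj]
  refine integral_congr_ae (Filter.Eventually.of_forall fun ψ => ?_)
  simp only
  rw [← Complex.star_def, ← Matrix.conjTranspose_apply, conjTranspose_tensorProj]

variable [Nonempty ι]

theorem moment_haar_mul_tensorProj (φ : EuclideanSpace ℂ ι) :
    moment k (haar ι) * tensorProj k φ = (symDim (Fintype.card ι) k : ℂ)⁻¹ • tensorProj k φ := by
  rw [tensorProj_eq_vecMulVec, Matrix.mul_vecMulVec, ← Matrix.smul_vecMulVec]
  congr 1
  funext i
  exact sum_moment_haar_mul_prod i fun x => φ x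

theorem tensorProj_mul_moment_haar (φ : EuclideanSpace ℂ ι) :
    tensorProj k φ * moment k (haar ι) = (symDim (Fintype.card ι) k : ℂ)⁻¹ • tensorProj k φ := by
  have := congrArg Matrix.conjTranspose (moment_haar_mul_tensorProj (k := k) φ)
  rw [Matrix.conjTranspose_mul, Matrix.conjTranspose_smul, conjTranspose_tensorProj,
    conjTranspose_moment_haar] at this
  rw [this]
  simp

/-- The Haar moment operator is a multiple of the projection onto the symmetric subspace. -/
theorem moment_haar_mul_self :
    moment k (haar ι) * moment k (haar ι) =
      (symDim (Fintype.card ι) k : ℂ)⁻¹ • moment k (haar ι) := by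
  ext i j
  have hcont : ∀ l : Fin k → ι, Continuous fun ψ : PureState ι =>
      moment k (haar ι) i l * tensorProj k (ψ : EuclideanSpace ℂ ι) l j := by
    intro l
    simp only [tensorProj, Matrix.of_apply]
    fun_prop
  calc (moment k (haar ι) * moment k (haar ι)) i j
      = ∑ l, ∫ ψ : PureState ι, moment k (haar ι) i l *
          tensorProj k (ψ : EuclideanSpace ℂ ι) l j ∂haar ι := by
        rw [Matrix.mul_apply]
        refine Finset.sum_congr rfl fun l _ => ?_
        rw [integral_const_mul]
        rfl
    _ = ∫ ψ : PureState ι, (moment k (haar ι) * tensorProj k (ψ : EuclideanSpace ℂ ι)) i j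
          ∂haar ι := by
        rw [← integral_finsetSum _ fun l _ => integrable_of_continuous (hcont l)]
        rfl
    _ = _ := by
        simp_rw [moment_haar_mul_tensorProj, Matrix.smul_apply, smul_eq_mul]
        rw [integral_const_mul]
        rfl

theorem trace_moment_haar : (moment k (haar ι)).trace = 1 := by
  have hcont : ∀ l : Fin k → ι, Continuous fun ψ : PureState ι =>
      tensorProj k (ψ : EuclideanSpace ℂ ι) l l := by
    intro l
    simp only [tensorProj, Matrix.of_apply]
    fun_prop
  calc (moment k (haar ι)).trace
      = ∫ ψ : PureState ι, (tensorProj k (ψ : EuclideanSpace ℂ ι)).trace ∂haar ι := by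
        simp only [Matrix.trace, Matrix.diag_apply]
        rw [integral_finsetSum _ fun l _ => integrable_of_continuous (hcont l)]
        rfl
    _ = 1 := by
        simp_rw [trace_tensorProj, norm_eq_of_mem_sphere]
        simp

theorem sum_norm_sq_eq_trace {n : Type*} [Fintype n] {Y : Matrix n n ℂ}
    (hY : Y.conjTranspose = Y) : ((∑ i, ∑ j, ‖Y i j‖ ^ 2 : ℝ) : ℂ) = (Y * Y).trace := by
  conv_rhs => rw [← hY]
  rw [hY, Complex.ofReal_sum, Matrix.trace]
  refine Finset.sum_congr rfl fun i _ => ?_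
  rw [Matrix.diag_apply, ← mul_conjTranspose_apply_self, hY]

theorem symDim_card_ne_zero : (symDim (Fintype.card ι) k : ℂ) ≠ 0 := by
  exact_mod_cast (symDim_pos Fintype.card_pos k).ne'

/-- The squared Hilbert-Schmidt norm of the projection onto the symmetric subspace is its rank. -/
theorem sum_norm_sq_symProj :
    ∑ i, ∑ j, ‖((symDim (Fintype.card ι) k : ℂ) • moment k (haar ι)) i j‖ ^ 2 =
      (symDim (Fintype.card ι) k : ℝ) := by
  apply Complex.ofReal_injective
  rw [sum_norm_sq_eq_trace (by
    rw [Matrix.conjTranspose_smul, conjTranspose_moment_haar]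
    simp)]
  rw [Matrix.smul_mul, Matrix.mul_smul, moment_haar_mul_self, Matrix.trace_smul, Matrix.trace_smul,
    Matrix.trace_smul, trace_moment_haar]
  have := symDim_card_ne_zero (ι := ι) (k := k)
  simp only [smul_eq_mul, mul_one, Complex.ofReal_natCast]
  field_simp

variable [DecidableEq ι]

/-- The trace distance of a combination of symmetric product states from the Haar moment operator,
estimated by the Hilbert-Schmidt distance and the dimension of the symmetric subspace. -/
theorem traceNorm_sum_tensorProj_sub_moment_haar_sq_le {κ : Type*} [Fintype κ] (c : ℝ)
    (φ : κ → EuclideanSpace ℂ ι) :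
    traceNorm ((c : ℂ) • ∑ s, tensorProj k (φ s) - moment k (haar ι)) ^ 2 ≤
      symDim (Fintype.card ι) k * (c ^ 2 * ∑ s, ∑ r, ‖inner ℂ (φ s) (φ r)‖ ^ (2 * k)) -
        2 * (c * ∑ s, ‖φ s‖ ^ (2 * k)) + 1 := by
  set d : ℝ := ((symDim (Fintype.card ι) k : ℕ) : ℝ) with hd
  set R := moment k (haar ι) with hR
  set T : Matrix (Fin k → ι) (Fin k → ι) ℂ := (c : ℂ) • ∑ s, tensorProj k (φ s) with hT
  have hd0 : (d : ℂ) ≠ 0 := by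
    rw [hd, Complex.ofReal_natCast]
    exact symDim_card_ne_zero
  have hdpos : 0 < d := by
    rw [hd]
    exact_mod_cast symDim_pos Fintype.card_pos k
  have hdc : (symDim (Fintype.card ι) k : ℂ) = d := by rw [hd, Complex.ofReal_natCast]
  have hTR : T * R = (d : ℂ)⁻¹ • T := by
    rw [hT, Matrix.smul_mul, Finset.sum_mul]
    simp_rw [hR, tensorProj_mul_moment_haar, hdc]
    rw [← Finset.smul_sum, smul_comm]
  have hRT : R * T = (d : ℂ)⁻¹ • T := by
    rw [hT, Matrix.mul_smul, Finset.mul_sum]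
    simp_rw [hR, moment_haar_mul_tensorProj, hdc]
    rw [← Finset.smul_sum, smul_comm]
  have hRR : R * R = (d : ℂ)⁻¹ • R := by
    rw [← hdc]
    exact moment_haar_mul_self
  have hTh : T.conjTranspose = T := by
    rw [hT, Matrix.conjTranspose_smul, Matrix.conjTranspose_sum]
    simp_rw [conjTranspose_tensorProj]
    simp
  have hY : (T - R) * ((symDim (Fintype.card ι) k : ℂ) • R) = T - R := by
    rw [Matrix.mul_smul, Matrix.sub_mul, hTR, hRR, ← smul_sub, smul_smul, hdc,
      mul_inv_cancel₀ hd0, one_smul]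
  have hHS : ∑ i, ∑ j, ‖(T - R) i j‖ ^ 2 =
      c ^ 2 * ∑ s, ∑ r, ‖inner ℂ (φ s) (φ r)‖ ^ (2 * k) -
        2 * d⁻¹ * (c * ∑ s, ‖φ s‖ ^ (2 * k)) + d⁻¹ := by
    apply Complex.ofReal_injective
    rw [sum_norm_sq_eq_trace (by
      rw [Matrix.conjTranspose_sub, hTh, hR, conjTranspose_moment_haar])]
    have h1 : (T * T).trace = ((c ^ 2 * ∑ s, ∑ r, ‖inner ℂ (φ s) (φ r)‖ ^ (2 * k) : ℝ) : ℂ) := by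
      rw [hT, Matrix.smul_mul, Matrix.mul_smul, Finset.sum_mul_sum, Matrix.trace_smul,
        Matrix.trace_smul, Matrix.trace_sum]
      simp_rw [Matrix.trace_sum, trace_tensorProj_mul]
      push_cast
      simp only [smul_eq_mul]
      ring
    have h2 : T.trace = ((c * ∑ s, ‖φ s‖ ^ (2 * k) : ℝ) : ℂ) := by
      rw [hT, Matrix.trace_smul, Matrix.trace_sum]
      simp_rw [trace_tensorProj]
      push_cast
      rfl
    rw [Matrix.sub_mul, Matrix.mul_sub, Matrix.mul_sub, hTR, hRT, hRR, Matrix.trace_sub,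
      Matrix.trace_sub, Matrix.trace_sub, h1, Matrix.trace_smul _ T, Matrix.trace_smul _ R, h2,
      hR, trace_moment_haar]
    push_cast
    simp only [smul_eq_mul]
    ring
  refine (pow_le_pow_left₀ (traceNorm_nonneg _) (traceNorm_le_of_mul_eq hY) 2).trans_eq ?_
  rw [mul_pow, Real.sq_sqrt (Finset.sum_nonneg fun _ _ => Finset.sum_nonneg fun _ _ => sq_nonneg _),
    Real.sq_sqrt (Finset.sum_nonneg fun _ _ => Finset.sum_nonneg fun _ _ => sq_nonneg _),
    sum_norm_sq_symProj, hHS, ← hd]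
  field_simp

theorem traceNorm_moment_haar_le : traceNorm (moment k (haar ι)) ≤ 1 := by
  have := traceNorm_sum_tensorProj_sub_moment_haar_sq_le (ι := ι) (k := k) (κ := Fin 0) 0
    (fun s => s.elim0)
  rw [← traceNorm_neg, ← sq_le_one_iff₀ (traceNorm_nonneg _)]
  simpa using this

end Operators

section Projected

variable {α β : Type*} [Fintype α] [Fintype β] {k : ℕ}

/-- The outcome probabilities sum to one. -/
theorem sum_norm_condState_sq (b : OrthonormalBasis β ℂ (EuclideanSpace ℂ β))
    (Ψ : EuclideanSpace ℂ (α × β)) : ∑ z, ‖condState (b z) Ψ‖ ^ 2 = ‖Ψ‖ ^ 2 := by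
  simp_rw [EuclideanSpace.norm_sq_eq]
  rw [Finset.sum_comm, Fintype.sum_prod_type]
  refine Finset.sum_congr rfl fun a => fun _ => ?_
  have h := b.sum_sq_norm_inner_right (WithLp.toLp 2 fun c => Ψ (a, c))
  rw [EuclideanSpace.norm_sq_eq] at h
  rw [← h]
  refine Finset.sum_congr rfl fun z _ => ?_
  rw [PiLp.inner_apply]
  simp [condState, mul_comm]

theorem norm_projState_le (v : EuclideanSpace ℂ β) (Ψ : EuclideanSpace ℂ (α × β)) :
    ‖projState v Ψ‖ ≤ 1 := by
  rw [projState, norm_smul, Complex.norm_real, norm_inv, norm_norm]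
  exact inv_mul_le_one

theorem tensorProj_condState (v : EuclideanSpace ℂ β) (Ψ : EuclideanSpace ℂ (α × β)) :
    tensorProj k (condState v Ψ) =
      ((‖condState v Ψ‖ ^ (2 * k) : ℝ) : ℂ) • tensorProj k (projState v Ψ) := by
  rw [← tensorProj_real_smul]
  congr 1
  rcases eq_or_ne (condState v Ψ) 0 with h | h
  · simp [h]
  · rw [projState, smul_smul, ← Complex.ofReal_mul, mul_inv_cancel₀ (norm_ne_zero_iff.2 h)]
    simp

variable [DecidableEq α]

theorem traceNorm_sum_smul_tensorProj_projState_le (c : β → ℝ) (v : β → EuclideanSpace ℂ β)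
    (Ψ : EuclideanSpace ℂ (α × β)) :
    traceNorm (∑ z, (c z : ℂ) • tensorProj k (projState (v z) Ψ)) ≤ ∑ z, |c z| := by
  simp_rw [tensorProj_eq_vecMulVec]
  refine (traceNorm_sum_smul_vecMulVec_le c _).trans (Finset.sum_le_sum fun z _ => ?_)
  rw [← norm_pow_eq_sum_norm_sq]
  exact mul_le_of_le_one_right (abs_nonneg _)
    (pow_le_one₀ (norm_nonneg _) (norm_projState_le _ _))

theorem measurable_traceNorm_projMoment_sub (b : OrthonormalBasis β ℂ (EuclideanSpace ℂ β)) :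
    Measurable fun Ψ : PureState (α × β) =>
      traceNorm (projMoment k b (Ψ : EuclideanSpace ℂ (α × β)) - moment k (haar α)) := by
  have hmeas : Measurable fun M : (Fin k → α) → (Fin k → α) → ℂ => traceNorm (Matrix.of M) :=
    (continuous_traceNorm.comp (by fun_prop : Continuous fun M : (Fin k → α) → (Fin k → α) → ℂ =>
      Matrix.of M)).measurable
  refine hmeas.comp (g := fun M : (Fin k → α) → (Fin k → α) → ℂ => traceNorm (Matrix.of M))
    (f := fun (Ψ : PureState (α × β)) i j =>
      (projMoment k b (Ψ : EuclideanSpace ℂ (α × β)) - moment k (haar α)) i j) ?_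
  have hc : ∀ z a, Measurable fun Ψ : PureState (α × β) =>
      condState (b z) (Ψ : EuclideanSpace ℂ (α × β)) a := fun z a =>
    Continuous.measurable (by fun_prop)
  have hn : ∀ z, Measurable fun Ψ : PureState (α × β) =>
      ‖condState (b z) (Ψ : EuclideanSpace ℂ (α × β))‖ := fun z =>
    Continuous.measurable (by fun_prop)
  refine measurable_pi_iff.2 fun i => measurable_pi_iff.2 fun j => ?_
  simp only [projMoment, Matrix.sub_apply, Matrix.sum_apply, Matrix.smul_apply, tensorProj,
    Matrix.of_apply, smul_eq_mul, outcomeProb, projState, PiLp.smul_apply]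
  refine Measurable.sub_const (Finset.measurable_fun_sum _ fun z _ => ?_) _
  have hp : ∀ a, Measurable fun Ψ : PureState (α × β) =>
      ((‖condState (b z) (Ψ : EuclideanSpace ℂ (α × β))‖⁻¹ : ℝ) : ℂ) *
        condState (b z) (Ψ : EuclideanSpace ℂ (α × β)) a := fun a =>
    (Complex.measurable_ofReal.comp (hn z).inv).mul (hc z a)
  exact (Complex.measurable_ofReal.comp ((hn z).pow_const 2)).mul
    (Finset.measurable_fun_prod _ fun t _ => (hp _).mul (continuous_star.measurable.comp (hp _)))

theorem traceNorm_projMoment_sub_le_two [Nonempty α]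
    (b : OrthonormalBasis β ℂ (EuclideanSpace ℂ β))
    (Ψ : PureState (α × β)) :
    traceNorm (projMoment k b (Ψ : EuclideanSpace ℂ (α × β)) - moment k (haar α)) ≤ 2 := by
  rw [sub_eq_add_neg]
  refine (traceNorm_add_le _ _).trans ?_
  rw [traceNorm_neg]
  have h1 := traceNorm_sum_smul_tensorProj_projState_le (k := k)
    (fun z => outcomeProb (b z) (Ψ : EuclideanSpace ℂ (α × β))) b
    (Ψ : EuclideanSpace ℂ (α × β))
  have h2 : ∑ z, |outcomeProb (b z) (Ψ : EuclideanSpace ℂ (α × β))| = 1 := by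
    simp only [outcomeProb, abs_pow, abs_norm]
    rw [sum_norm_condState_sq, norm_eq_of_mem_sphere, one_pow]
  rw [h2] at h1
  have h3 := traceNorm_moment_haar_le (ι := α) (k := k)
  unfold projMoment
  linarith

/-- Replacing the weights `p_z` of the projected ensemble by `c p_z ^ k` turns its moment operator
into a polynomial in the total state. -/
theorem traceNorm_projMoment_sub_le (b : OrthonormalBasis β ℂ (EuclideanSpace ℂ β)) (c : ℝ)
    (Ψ : PureState (α × β)) :
    traceNorm (projMoment k b (Ψ : EuclideanSpace ℂ (α × β)) - moment k (haar α)) ≤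
      ∑ z, |‖condState (b z) (Ψ : EuclideanSpace ℂ (α × β))‖ ^ 2 -
        c * ‖condState (b z) (Ψ : EuclideanSpace ℂ (α × β))‖ ^ (2 * k)| +
      traceNorm ((c : ℂ) • ∑ z, tensorProj k (condState (b z) (Ψ : EuclideanSpace ℂ (α × β))) -
        moment k (haar α)) := by
  have h1 := traceNorm_sum_smul_tensorProj_projState_le (k := k)
    (fun z => ‖condState (b z) (Ψ : EuclideanSpace ℂ (α × β))‖ ^ 2 -
        c * ‖condState (b z) (Ψ : EuclideanSpace ℂ (α × β))‖ ^ (2 * k)) b (Ψ : EuclideanSpace ℂ (α × β))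
  refine le_trans (le_of_eq_of_le ?_ (traceNorm_add_le _ _)) (add_le_add_left h1 _)
  congr 1
  rw [← add_sub_assoc]
  congr 1
  simp_rw [tensorProj_condState]
  rw [Finset.smul_sum, ← Finset.sum_add_distrib]
  refine Finset.sum_congr rfl fun z _ => ?_
  rw [smul_smul, ← add_smul, outcomeProb]
  congr 1
  push_cast
  ring

theorem continuous_traceNorm_sum_tensorProj_sub (v : β → EuclideanSpace ℂ β) (c : ℂ)
    (M : Matrix (Fin k → α) (Fin k → α) ℂ) : Continuous fun Ψ : PureState (α × β) =>
      traceNorm (c • ∑ z, tensorProj k (condState (v z) (Ψ : EuclideanSpace ℂ (α × β))) - M) := by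
  refine continuous_traceNorm.comp ?_
  refine Continuous.sub (Continuous.const_smul (continuous_finsetSum _ fun z _ => ?_) c)
    continuous_const
  refine continuous_matrix fun i j => ?_
  simp only [tensorProj, Matrix.of_apply]
  fun_prop

theorem integrable_traceNorm_projMoment_sub [Nonempty α]
    (b : OrthonormalBasis β ℂ (EuclideanSpace ℂ β))
    (μ : Measure (PureState (α × β))) [IsFiniteMeasure μ] :
    Integrable (fun Ψ : PureState (α × β) =>
      traceNorm (projMoment k b (Ψ : EuclideanSpace ℂ (α × β)) - moment k (haar α))) μ := by
  refine Integrable.of_bound (measurable_traceNorm_projMoment_sub b).aestronglyMeasurable 2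
    (Filter.Eventually.of_forall fun Ψ => ?_)
  rw [Real.norm_of_nonneg (traceNorm_nonneg _)]
  exact traceNorm_projMoment_sub_le_two b Ψ

end Projected

/-! ### Estimates for rising factorials -/

section Arithmetic

theorem ascFactorial_le_pow_mul_exp {n : ℕ} (hn : 0 < n) (m : ℕ) :
    (n.ascFactorial m : ℝ) ≤ (n : ℝ) ^ m * Real.exp ((m : ℝ) ^ 2 / (2 * n)) := by
  have hn' : (0 : ℝ) < n := by exact_mod_cast hn
  induction m with
  | zero => simp
  | succ m ih =>
    rw [Nat.ascFactorial_succ]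
    push_cast
    have h1 : (n + m : ℝ) ≤ n * Real.exp (m / n) := by
      have := Real.add_one_le_exp ((m : ℝ) / n)
      calc (n + m : ℝ) = n * (m / n + 1) := by field_simp; ring
        _ ≤ _ := mul_le_mul_of_nonneg_left this hn'.le
    have h2 : Real.exp (m / n) * Real.exp ((m : ℝ) ^ 2 / (2 * n)) ≤
        Real.exp (((m : ℝ) + 1) ^ 2 / (2 * n)) := by
      rw [← Real.exp_add, Real.exp_le_exp, div_add_div _ _ hn'.ne' (by positivity),
        div_le_div_iff₀ (by positivity) (by positivity)]
      have : 0 ≤ (n : ℝ) * n * n := by positivity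
      nlinarith
    calc (n + m : ℝ) * n.ascFactorial m
        ≤ (n * Real.exp (m / n)) * ((n : ℝ) ^ m * Real.exp ((m : ℝ) ^ 2 / (2 * n))) :=
          mul_le_mul h1 ih (Nat.cast_nonneg _) (by positivity)
      _ = (n : ℝ) ^ (m + 1) * (Real.exp (m / n) * Real.exp ((m : ℝ) ^ 2 / (2 * n))) := by ring
      _ ≤ _ := mul_le_mul_of_nonneg_left h2 (by positivity)

/-- The Haar average of `p_z ^ m`, relative to its value `dB ^ (-m)` for a uniform outcome
distribution. -/
noncomputable def momentRatio (dA dB m : ℕ) : ℝ :=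
  (dB : ℝ) ^ m * ((dA.ascFactorial m : ℝ) / ((dA * dB).ascFactorial m : ℝ))

variable {dA dB : ℕ}

theorem ascFactorial_cast_pos (hA : 0 < dA) (m : ℕ) : (0 : ℝ) < dA.ascFactorial m := by
  exact_mod_cast Nat.pos_of_ne_zero (ascFactorial_ne_zero hA m)

theorem one_le_momentRatio (hA : 0 < dA) (hB : 0 < dB) (m : ℕ) : 1 ≤ momentRatio dA dB m := by
  unfold momentRatio
  rw [← mul_div_assoc, one_le_div (ascFactorial_cast_pos (Nat.mul_pos hA hB) m)]
  norm_cast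
  induction m with
  | zero => simp
  | succ m ih =>
    rw [Nat.ascFactorial_succ, Nat.ascFactorial_succ, pow_succ]
    calc (dA * dB + m) * (dA * dB).ascFactorial m
        ≤ (dB * (dA + m)) * (dB ^ m * dA.ascFactorial m) := by
          refine Nat.mul_le_mul ?_ ih
          nlinarith
      _ = _ := by ring

theorem momentRatio_le_succ (hA : 0 < dA) (hB : 0 < dB) (m : ℕ) :
    momentRatio dA dB m ≤ momentRatio dA dB (m + 1) := by
  have hpos := ascFactorial_cast_pos (Nat.mul_pos hA hB) m
  have hA' := ascFactorial_cast_pos hA m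
  have hB' : (1 : ℝ) ≤ dB := by exact_mod_cast hB
  have hA1 : (1 : ℝ) ≤ dA := by exact_mod_cast hA
  have hm : (0 : ℝ) ≤ m := Nat.cast_nonneg m
  have hD : (0 : ℝ) < dA * dB + m := by nlinarith
  unfold momentRatio
  rw [Nat.ascFactorial_succ, Nat.ascFactorial_succ]
  push_cast
  have h1 : (1 : ℝ) ≤ dB * (dA + m) / (dA * dB + m) := by
    rw [one_le_div hD]
    nlinarith
  calc (dB : ℝ) ^ m * ((dA.ascFactorial m : ℝ) / ((dA * dB).ascFactorial m : ℝ))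
      ≤ ((dB : ℝ) ^ m * ((dA.ascFactorial m : ℝ) / ((dA * dB).ascFactorial m : ℝ))) *
          (dB * (dA + m) / (dA * dB + m)) := le_mul_of_one_le_right (by positivity) h1
    _ = _ := by
      field_simp
      ring

theorem momentRatio_le_exp (hA : 0 < dA) (hB : 0 < dB) (m : ℕ) :
    momentRatio dA dB m ≤ Real.exp ((m : ℝ) ^ 2 / (2 * dA)) := by
  unfold momentRatio
  rw [← mul_div_assoc, div_le_iff₀ (ascFactorial_cast_pos (Nat.mul_pos hA hB) m)]
  have h1 := ascFactorial_le_pow_mul_exp hA m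
  have h2 : ((dA * dB : ℝ)) ^ m ≤ ((dA * dB).ascFactorial m : ℝ) := by
    exact_mod_cast Nat.pow_succ_le_ascFactorial (dA * dB) m
  calc (dB : ℝ) ^ m * dA.ascFactorial m
      ≤ (dB : ℝ) ^ m * ((dA : ℝ) ^ m * Real.exp ((m : ℝ) ^ 2 / (2 * dA))) :=
        mul_le_mul_of_nonneg_left h1 (by positivity)
    _ = Real.exp ((m : ℝ) ^ 2 / (2 * dA)) * ((dA * dB : ℝ)) ^ m := by ring
    _ ≤ _ := mul_le_mul_of_nonneg_left h2 (Real.exp_nonneg _)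

theorem exp_two_mul_le {x : ℝ} (h0 : 0 ≤ x) (h1 : x ≤ 1) : Real.exp (2 * x) ≤ 1 + 7 * x := by
  have h := convexOn_exp.2 (Set.mem_univ 0) (Set.mem_univ 2) (sub_nonneg.2 h1) h0 (by ring)
  simp only [smul_eq_mul, mul_zero, zero_add, Real.exp_zero, mul_one] at h
  have h2 : Real.exp 2 ≤ 8 := by
    have h3 : Real.exp 2 = Real.exp 1 ^ 2 := by rw [← Real.exp_nat_mul]; norm_num
    have h4 := Real.exp_one_lt_d9
    have h5 := Real.exp_pos 1
    rw [h3]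
    nlinarith
  rw [mul_comm 2 x]
  nlinarith

theorem momentRatio_two_mul_le (hA : 0 < dA) (hB : 0 < dB) {k : ℕ}
    (hk : (k : ℝ) ^ 2 / dA ≤ 1) : momentRatio dA dB (2 * k) ≤ 1 + 7 * ((k : ℝ) ^ 2 / dA) := by
  refine (momentRatio_le_exp hA hB _).trans ?_
  have hA' : (0 : ℝ) < dA := by exact_mod_cast hA
  have h1 : ((2 * k : ℕ) : ℝ) ^ 2 / (2 * dA) = 2 * ((k : ℝ) ^ 2 / dA) := by
    push_cast
    field_simp
  rw [h1]
  exact exp_two_mul_le (by positivity) hk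

theorem symDim_le_pow_div_factorial (hA : 0 < dA) {k : ℕ} (hk : (k : ℝ) ^ 2 / dA ≤ 1) :
    (symDim dA k : ℝ) ≤ (dA : ℝ) ^ k / k.factorial * (1 + (k : ℝ) ^ 2 / dA) := by
  have hA' : (0 : ℝ) < dA := by exact_mod_cast hA
  have hfac : (0 : ℝ) < k.factorial := by exact_mod_cast k.factorial_pos
  have h1 : (k.factorial * symDim dA k : ℝ) = dA.ascFactorial k := by
    exact_mod_cast symDim_mul_factorial dA k
  have h2 := ascFactorial_le_pow_mul_exp hA k
  have h3 : Real.exp ((k : ℝ) ^ 2 / (2 * dA)) ≤ 1 + (k : ℝ) ^ 2 / dA := by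
    set x := (k : ℝ) ^ 2 / dA with hx
    have hx0 : 0 ≤ x := by positivity
    have h4 : (k : ℝ) ^ 2 / (2 * dA) = x / 2 := by rw [hx]; field_simp
    have h5 := Real.exp_bound_div_one_sub_of_interval (x := x / 2) (by linarith) (by linarith)
    rw [h4]
    refine h5.trans ?_
    rw [div_le_iff₀ (by linarith)]
    nlinarith
  rw [div_mul_eq_mul_div, le_div_iff₀ hfac, mul_comm, h1]
  exact h2.trans (mul_le_mul_of_nonneg_left h3 (by positivity))

theorem le_symDim (hA : 0 < dA) {k : ℕ} (hk : 1 ≤ k) : dA ≤ symDim dA k := by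
  induction k, hk using Nat.le_induction with
  | base => simp [symDim]
  | succ k _ ih =>
    refine ih.trans ?_
    unfold symDim
    have h1 : dA + (k + 1) - 1 = (dA + k - 1) + 1 := by omega
    rw [h1, Nat.choose_succ_succ]
    exact Nat.le_add_right _ _

theorem factorial_mul_ascFactorial_div_le (hA : 0 < dA) (D k : ℕ) :
    (k.factorial * dA.ascFactorial k : ℝ) / (D.ascFactorial (2 * k) : ℝ) ≤
      (symDim dA k : ℝ)⁻¹ * ((dA.ascFactorial (2 * k) : ℝ) / (D.ascFactorial (2 * k) : ℝ)) := by
  rw [← mul_div_assoc]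
  refine div_le_div_of_nonneg_right ?_ (Nat.cast_nonneg _)
  have hd : (0 : ℝ) < symDim dA k := by exact_mod_cast symDim_pos hA k
  rw [le_inv_mul_iff₀ hd]
  norm_cast
  rw [← mul_assoc, mul_comm (symDim dA k), symDim_mul_factorial, two_mul,
    ← Nat.ascFactorial_mul_ascFactorial]
  exact Nat.mul_le_mul_left _ (Nat.ascFactorial_le k (Nat.le_add_right _ _))

end Arithmetic

/-! ### Averaging over the design -/

theorem integral_le_sqrt {Ω : Type*} [MeasurableSpace Ω] {μ : Measure Ω} [IsProbabilityMeasure μ]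
    {f g : Ω → ℝ} (hf : Integrable f μ) (hf2 : Integrable (fun x => f x ^ 2) μ)
    (hg : Integrable g μ) (h : ∀ x, f x ^ 2 ≤ g x) {c : ℝ} (hc : ∫ x, g x ∂μ ≤ c) :
    ∫ x, f x ∂μ ≤ Real.sqrt c := by
  set m := ∫ x, f x ∂μ with hm
  have h1 : ∫ x, (f x - m) ^ 2 ∂μ = ∫ x, f x ^ 2 ∂μ - m ^ 2 := by
    have : ∀ x, (f x - m) ^ 2 = f x ^ 2 - (2 * m) * f x + m ^ 2 := fun x => by ring
    simp_rw [this]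
    have hi : Integrable (fun x => f x ^ 2 - (2 * m) * f x) μ := hf2.sub (hf.const_mul _)
    rw [integral_add hi (integrable_const _), integral_sub hf2 (hf.const_mul _),
      integral_const_mul, ← hm]
    simp
    ring
  have h2 : 0 ≤ ∫ x, (f x - m) ^ 2 ∂μ := integral_nonneg fun x => sq_nonneg _
  have h3 := integral_mono hf2 hg h
  exact Real.le_sqrt_of_sq_le (by linarith)

section Average

variable {α β : Type*} [Fintype α] [Fintype β] [Nonempty α] [Nonempty β] {k : ℕ} {ε : ℝ}
  {μ : Measure (PureState (α × β))}

theorem integral_inner_condState_pow_design_le [DecidableEq β] [IsFiniteMeasure μ]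
    (h : IsDesignRel (2 * k) ε μ) (b : OrthonormalBasis β ℂ (EuclideanSpace ℂ β)) (z w : β) :
    ∫ Ψ : PureState (α × β), ‖inner ℂ (condState (b z) (Ψ : EuclideanSpace ℂ (α × β)))
        (condState (b w) (Ψ : EuclideanSpace ℂ (α × β)))‖ ^ (2 * k) ∂μ ≤
      ((if z = w then 1 else 0) + (symDim (Fintype.card α) k : ℝ)⁻¹ + ε) *
        (((Fintype.card α).ascFactorial (2 * k) : ℝ) /
          ((Fintype.card α * Fintype.card β).ascFactorial (2 * k) : ℝ)) := by
  set q := ((Fintype.card α).ascFactorial (2 * k) : ℝ) /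
          ((Fintype.card α * Fintype.card β).ascFactorial (2 * k) : ℝ) with hq
  have hq0 : 0 ≤ q := by positivity
  have hdpos : (0 : ℝ) < symDim (Fintype.card α) k := by
    exact_mod_cast symDim_pos Fintype.card_pos k
  refine (h.integral_inner_condState_pow_le b z w).trans ?_
  have hG : ∫ Ψ : PureState (α × β), ‖condState (b z) (Ψ : EuclideanSpace ℂ (α × β))‖ ^ (2 * k) *
        ‖condState (b w) (Ψ : EuclideanSpace ℂ (α × β))‖ ^ (2 * k) ∂haar (α × β) ≤ q := by
    have hmono : ∫ Ψ : PureState (α × β),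
        ‖condState (b z) (Ψ : EuclideanSpace ℂ (α × β))‖ ^ (2 * k) *
        ‖condState (b w) (Ψ : EuclideanSpace ℂ (α × β))‖ ^ (2 * k) ∂haar (α × β) ≤
        ∫ Ψ : PureState (α × β),
          (‖condState (b z) (Ψ : EuclideanSpace ℂ (α × β))‖ ^ (2 * (2 * k)) / 2 +
          ‖condState (b w) (Ψ : EuclideanSpace ℂ (α × β))‖ ^ (2 * (2 * k)) / 2) ∂haar (α × β) := by
      refine integral_mono (integrable_of_continuous (by fun_prop))
        (integrable_of_continuous (by fun_prop)) fun Ψ => ?_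
      simp only
      rw [mul_comm 2 (2 * k), pow_mul _ (2 * k) 2, pow_mul _ (2 * k) 2]
      nlinarith [sq_nonneg (‖condState (b z) (Ψ : EuclideanSpace ℂ (α × β))‖ ^ (2 * k) -
        ‖condState (b w) (Ψ : EuclideanSpace ℂ (α × β))‖ ^ (2 * k))]
    rw [integral_add (integrable_of_continuous (by fun_prop))
      (integrable_of_continuous (by fun_prop)), integral_div, integral_div,
      integral_norm_condState_pow, integral_norm_condState_pow, ← hq] at hmono
    linarith
  have hF : ∫ Ψ : PureState (α × β), ‖inner ℂ (condState (b z) (Ψ : EuclideanSpace ℂ (α × β)))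
        (condState (b w) (Ψ : EuclideanSpace ℂ (α × β)))‖ ^ (2 * k) ∂haar (α × β) ≤
      ((if z = w then 1 else 0) + (symDim (Fintype.card α) k : ℝ)⁻¹) * q := by
    by_cases hzw : z = w
    · subst hzw
      have h1 : ∀ φ : EuclideanSpace ℂ α, ‖inner ℂ φ φ‖ ^ (2 * k) = ‖φ‖ ^ (2 * (2 * k)) := by
        intro φ
        rw [inner_self_eq_norm_sq_to_K]
        simp [← pow_mul]
      simp_rw [h1]
      rw [integral_norm_condState_pow, ← hq, if_pos trivial]
      have : 0 ≤ (symDim (Fintype.card α) k : ℝ)⁻¹ * q := by positivity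
      linarith
    · rw [if_neg hzw, zero_add]
      exact (DeepTherm.integral_inner_condState_pow_le b hzw k).trans
        (factorial_mul_ascFactorial_div_le Fintype.card_pos _ k)
  have := mul_le_mul_of_nonneg_left hG h.nonneg
  linarith

/-- The average trace of the polynomial approximation of the projected ensemble. -/
theorem one_sub_le_integral_sum_norm_pow [IsFiniteMeasure μ] (hk : 1 ≤ k)
    (h : IsDesignRel (2 * k) ε μ) (hε : ε ≤ 1)
    (b : OrthonormalBasis β ℂ (EuclideanSpace ℂ β)) :
    1 - ε ≤ (Fintype.card β : ℝ) ^ (k - 1) * ∑ z, ∫ Ψ : PureState (α × β),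
      ‖condState (b z) (Ψ : EuclideanSpace ℂ (α × β))‖ ^ (2 * k) ∂μ := by
  set c : ℝ := (Fintype.card β : ℝ) ^ (k - 1) with hc
  have hc0 : 0 ≤ c := by positivity
  have hcB : c * Fintype.card β = (Fintype.card β : ℝ) ^ k := by
    rw [hc, ← pow_succ, Nat.sub_add_cancel hk]
  have h3 := fun z => (h.integral_norm_condState_pow b z (m := k) (by omega)).1
  have h4 := Finset.sum_le_sum fun z (_ : z ∈ Finset.univ) => h3 z
  rw [Finset.sum_const, Finset.card_univ, nsmul_eq_mul] at h4
  refine le_trans ?_ (mul_le_mul_of_nonneg_left h4 hc0)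
  have h6 := one_le_momentRatio (Fintype.card_pos (α := α)) (Fintype.card_pos (α := β)) k
  rw [momentRatio, ← hcB] at h6
  calc 1 - ε = (1 - ε) * 1 := (mul_one _).symm
    _ ≤ (1 - ε) * _ := mul_le_mul_of_nonneg_left h6 (by linarith)
    _ = _ := by ring

variable [IsProbabilityMeasure μ]

/-- The average trace distance between the polynomial approximation of the projected ensemble and
the Haar ensemble. -/
theorem integral_traceNorm_sum_tensorProj_sub_le [DecidableEq α] (hk : 1 ≤ k)
    (h : IsDesignRel (2 * k) ε μ) (hε : ε ≤ 1)
    (b : OrthonormalBasis β ℂ (EuclideanSpace ℂ β)) :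
    ∫ Ψ : PureState (α × β), traceNorm ((((Fintype.card β : ℝ) ^ (k - 1) : ℝ) : ℂ) •
        ∑ z, tensorProj k (condState (b z) (Ψ : EuclideanSpace ℂ (α × β))) -
          moment k (haar α)) ∂μ ≤
      Real.sqrt ((symDim (Fintype.card α) k : ℝ) / Fintype.card β *
          momentRatio (Fintype.card α) (Fintype.card β) (2 * k) +
        (momentRatio (Fintype.card α) (Fintype.card β) (2 * k) - 1) +
        ε * (2 + symDim (Fintype.card α) k *
          momentRatio (Fintype.card α) (Fintype.card β) (2 * k))) := by
  classical
  set c : ℝ := (Fintype.card β : ℝ) ^ (k - 1) with hc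
  set d : ℝ := ((symDim (Fintype.card α) k : ℕ) : ℝ) with hd
  have hdpos : (0 : ℝ) < d := by
    rw [hd]
    exact_mod_cast symDim_pos Fintype.card_pos k
  have hBpos : (0 : ℝ) < Fintype.card β := by exact_mod_cast Fintype.card_pos
  have hc0 : 0 ≤ c := by positivity
  have hcB : c * Fintype.card β = (Fintype.card β : ℝ) ^ k := by
    rw [hc, ← pow_succ, Nat.sub_add_cancel hk]
  have hcont := continuous_traceNorm_sum_tensorProj_sub b (c : ℂ) (moment k (haar α))
  refine integral_le_sqrt (integrable_of_continuous hcont)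
    (integrable_of_continuous (hcont.pow 2)) (integrable_of_continuous ?_)
    (fun Ψ => traceNorm_sum_tensorProj_sub_moment_haar_sq_le c
      fun z => condState (b z) (Ψ : EuclideanSpace ℂ (α × β))) ?_
  · fun_prop
  rw [← hd, integral_add (integrable_of_continuous (by fun_prop))
      (integrable_of_continuous (by fun_prop)),
    integral_sub (integrable_of_continuous (by fun_prop))
      (integrable_of_continuous (by fun_prop)), integral_const_mul, integral_const_mul,
    integral_const_mul, integral_const_mul,
    integral_finsetSum _ fun z _ => integrable_of_continuous (by fun_prop),
    integral_finsetSum _ fun z _ => integrable_of_continuous (by fun_prop)]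
  have hsum : ∀ z, ∫ Ψ : PureState (α × β), ∑ w,
      ‖inner ℂ (condState (b z) (Ψ : EuclideanSpace ℂ (α × β)))
        (condState (b w) (Ψ : EuclideanSpace ℂ (α × β)))‖ ^ (2 * k) ∂μ =
      ∑ w, ∫ Ψ : PureState (α × β),
      ‖inner ℂ (condState (b z) (Ψ : EuclideanSpace ℂ (α × β)))
        (condState (b w) (Ψ : EuclideanSpace ℂ (α × β)))‖ ^ (2 * k) ∂μ := fun z =>
    integral_finsetSum _ fun w _ => integrable_of_continuous (by fun_prop)
  simp_rw [hsum]
  set q := ((Fintype.card α).ascFactorial (2 * k) : ℝ) /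
          ((Fintype.card α * Fintype.card β).ascFactorial (2 * k) : ℝ) with hq
  set a := momentRatio (Fintype.card α) (Fintype.card β) (2 * k) with ha
  have haq : a = (c * Fintype.card β) ^ 2 * q := by
    rw [ha, momentRatio, ← hq, hcB, ← pow_mul, mul_comm k 2]
  have h1 : ∑ z, ∑ w, ∫ Ψ : PureState (α × β),
      ‖inner ℂ (condState (b z) (Ψ : EuclideanSpace ℂ (α × β)))
        (condState (b w) (Ψ : EuclideanSpace ℂ (α × β)))‖ ^ (2 * k) ∂μ ≤
      (Fintype.card β + Fintype.card β ^ 2 * (d⁻¹ + ε)) * q := by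
    refine (Finset.sum_le_sum fun z _ => Finset.sum_le_sum fun w _ =>
      integral_inner_condState_pow_design_le h b z w).trans_eq ?_
    simp_rw [← Finset.sum_mul, add_assoc, Finset.sum_add_distrib]
    simp [← hd]
    ring
  have h2 : 1 - ε ≤ c * ∑ z, ∫ Ψ : PureState (α × β),
      ‖condState (b z) (Ψ : EuclideanSpace ℂ (α × β))‖ ^ (2 * k) ∂μ :=
    one_sub_le_integral_sum_norm_pow hk h hε b
  have h3 : d * (c ^ 2 * ∑ z, ∑ w, ∫ Ψ : PureState (α × β),
      ‖inner ℂ (condState (b z) (Ψ : EuclideanSpace ℂ (α × β)))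
        (condState (b w) (Ψ : EuclideanSpace ℂ (α × β)))‖ ^ (2 * k) ∂μ) ≤
      d / Fintype.card β * a + a + ε * d * a := by
    refine (mul_le_mul_of_nonneg_left (mul_le_mul_of_nonneg_left h1 (sq_nonneg c))
      hdpos.le).trans_eq ?_
    rw [haq]
    field_simp
    ring
  simp only [integral_const, probReal_univ, smul_eq_mul, mul_one]
  linarith

/-- The average error of replacing the outcome probabilities `p_z` by `c p_z ^ k`. -/
theorem integral_sum_abs_sub_le (hk : 1 ≤ k) (h : IsDesignRel (2 * k) ε μ) (hε : ε ≤ 1)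
    (b : OrthonormalBasis β ℂ (EuclideanSpace ℂ β)) :
    ∫ Ψ : PureState (α × β), ∑ z, |‖condState (b z) (Ψ : EuclideanSpace ℂ (α × β))‖ ^ 2 -
        (Fintype.card β : ℝ) ^ (k - 1) *
          ‖condState (b z) (Ψ : EuclideanSpace ℂ (α × β))‖ ^ (2 * k)| ∂μ ≤
      Real.sqrt ((momentRatio (Fintype.card α) (Fintype.card β) (2 * k) - 1) +
        ε * (2 + momentRatio (Fintype.card α) (Fintype.card β) (2 * k))) := by
  set c : ℝ := (Fintype.card β : ℝ) ^ (k - 1) with hc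
  obtain ⟨l, rfl⟩ := Nat.exists_eq_add_of_le' hk
  have hpt : ∀ Ψ : PureState (α × β),
      (∑ z, |‖condState (b z) (Ψ : EuclideanSpace ℂ (α × β))‖ ^ 2 -
        c * ‖condState (b z) (Ψ : EuclideanSpace ℂ (α × β))‖ ^ (2 * (l + 1))|) ^ 2 ≤
      1 - 2 * (c * ∑ z, ‖condState (b z) (Ψ : EuclideanSpace ℂ (α × β))‖ ^ (2 * (l + 1))) +
        c ^ 2 * ∑ z, ‖condState (b z) (Ψ : EuclideanSpace ℂ (α × β))‖ ^ (2 * (2 * l + 1)) := by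
    intro Ψ
    set x : β → ℝ := fun z => ‖condState (b z) (Ψ : EuclideanSpace ℂ (α × β))‖ with hx
    have hx1 : ∑ z, x z ^ 2 = 1 := by
      rw [hx, sum_norm_condState_sq, norm_eq_of_mem_sphere, one_pow]
    have h1 : ∀ z, |x z ^ 2 - c * x z ^ (2 * (l + 1))| =
        x z * |x z - c * x z ^ (2 * l + 1)| := by
      intro z
      have hxz : 0 ≤ x z := norm_nonneg _
      rw [← abs_of_nonneg hxz, ← abs_mul, abs_of_nonneg hxz]
      congr 1
      ring
    have h2 := Finset.sum_mul_sq_le_sq_mul_sq Finset.univ x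
      fun z => |x z - c * x z ^ (2 * l + 1)|
    rw [hx1, one_mul] at h2
    change (∑ z, |x z ^ 2 - c * x z ^ (2 * (l + 1))|) ^ 2 ≤
      1 - 2 * (c * ∑ z, x z ^ (2 * (l + 1))) + c ^ 2 * ∑ z, x z ^ (2 * (2 * l + 1))
    simp_rw [h1]
    refine h2.trans_eq ?_
    rw [← hx1, Finset.mul_sum, Finset.mul_sum, Finset.mul_sum, ← Finset.sum_sub_distrib,
      ← Finset.sum_add_distrib]
    refine Finset.sum_congr rfl fun z _ => ?_
    rw [sq_abs]
    ring
  refine integral_le_sqrt (integrable_of_continuous (by fun_prop))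
    (integrable_of_continuous (by fun_prop)) (integrable_of_continuous (by fun_prop)) hpt ?_
  rw [integral_add (integrable_of_continuous (by fun_prop))
      (integrable_of_continuous (by fun_prop)),
    integral_sub (integrable_of_continuous (by fun_prop))
      (integrable_of_continuous (by fun_prop)), integral_const_mul, integral_const_mul,
    integral_const_mul,
    integral_finsetSum _ fun z _ => integrable_of_continuous (by fun_prop),
    integral_finsetSum _ fun z _ => integrable_of_continuous (by fun_prop)]
  set a := momentRatio (Fintype.card α) (Fintype.card β) (2 * (l + 1)) with ha
  have hε0 := h.nonneg
  have h2 : 1 - ε ≤ c * ∑ z, ∫ Ψ : PureState (α × β),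
      ‖condState (b z) (Ψ : EuclideanSpace ℂ (α × β))‖ ^ (2 * (l + 1)) ∂μ :=
    one_sub_le_integral_sum_norm_pow hk h hε b
  have h3 : c ^ 2 * ∑ z, ∫ Ψ : PureState (α × β),
      ‖condState (b z) (Ψ : EuclideanSpace ℂ (α × β))‖ ^ (2 * (2 * l + 1)) ∂μ ≤
      (1 + ε) * a := by
    have h3 := fun z => (h.integral_norm_condState_pow b z (m := 2 * l + 1) (by omega)).2
    have h4 := Finset.sum_le_sum fun z (_ : z ∈ Finset.univ) => h3 z
    rw [Finset.sum_const, Finset.card_univ, nsmul_eq_mul] at h4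
    refine (mul_le_mul_of_nonneg_left h4 (sq_nonneg c)).trans ?_
    have h6 := momentRatio_le_succ (Fintype.card_pos (α := α)) (Fintype.card_pos (α := β))
      (2 * l + 1)
    refine le_trans (le_of_eq ?_) (mul_le_mul_of_nonneg_left h6 (by linarith))
    rw [momentRatio, hc, Nat.add_sub_cancel]
    ring
  simp only [integral_const, probReal_univ, smul_eq_mul, mul_one]
  linarith

end Average

/-! ### Combining the error terms -/

/-- The two error terms merge into one square root. Here `d` is the dimension of the symmetric
subspace, `t = 1 / dB`, `a` is the moment ratio, `x = k ^ 2 / dA` and `r = √(x d t)`. -/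
theorem sqrt_add_sqrt_le {d t a x ε r : ℝ} (hd : 1 ≤ d) (ht : 0 ≤ t) (hdt : d * t ≤ 4)
    (ha : 1 ≤ a) (hax : a ≤ 1 + 7 * x) (hx0 : 0 ≤ x) (hx1 : x ≤ 1) (hε : 0 ≤ ε)
    (hr0 : 0 ≤ r) (hr : r ^ 2 = x * (d * t)) (htr : t ≤ r) :
    Real.sqrt (a - 1 + ε * (2 + a)) + Real.sqrt (d * t * a + (a - 1) + ε * (2 + d * a)) ≤
      Real.sqrt (d * t + 100 * (x + d * ε + r)) := by
  have hdt0 : 0 ≤ d * t := by positivity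
  set y := d * ε with hy
  have hεy : ε ≤ y := by nlinarith
  have hy0 : 0 ≤ y := hε.trans hεy
  have ha8 : a ≤ 8 := by linarith
  have hεa : ε * a ≤ ε * 8 := mul_le_mul_of_nonneg_left ha8 hε
  have hya : y * a ≤ y * 8 := mul_le_mul_of_nonneg_left ha8 hy0
  have hB : a - 1 + ε * (2 + a) ≤ 7 * x + 10 * ε := by linarith
  have hA : d * t * a + (a - 1) + ε * (2 + d * a) ≤ d * t + (35 * x + 10 * y) := by
    have h1 : d * t * a ≤ d * t * (1 + 7 * x) := mul_le_mul_of_nonneg_left hax hdt0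
    have h2 : d * t * x ≤ 4 * x := mul_le_mul_of_nonneg_right hdt hx0
    have h3 : ε * (d * a) = y * a := by rw [hy]; ring
    nlinarith
  set B := 7 * x + 10 * ε with hBdef
  set A := d * t + (35 * x + 10 * y) with hAdef
  have hB0 : 0 ≤ B := by positivity
  have hA0 : 0 ≤ A := by positivity
  refine (add_le_add (Real.sqrt_le_sqrt hB) (Real.sqrt_le_sqrt hA)).trans ?_
  have hprod : Real.sqrt B * Real.sqrt A ≤ 21 * x + 15 * y + 4 * r := by
    rw [← Real.sqrt_mul hB0]
    refine Real.sqrt_le_iff.2 ⟨by positivity, ?_⟩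
    have h1 : d * t * ε ≤ r * y := by
      have : d * t * ε = t * y := by rw [hy]; ring
      rw [this]
      exact mul_le_mul_of_nonneg_right htr hy0
    have h2 : B * (35 * x + 10 * y) ≤ (7 * x + 10 * y) * (35 * x + 10 * y) :=
      mul_le_mul_of_nonneg_right (by linarith) (by positivity)
    have h3 : B * (d * t) = 7 * r ^ 2 + 10 * (d * t * ε) := by rw [hr, hBdef]; ring
    have h4 : 0 ≤ x * y := by positivity
    have h5 : 0 ≤ x * r := by positivity
    have h6 : 0 ≤ r * y := by positivity
    have h7 := sq_nonneg x
    have h8 := sq_nonneg y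
    have h9 := sq_nonneg r
    rw [hAdef, mul_add]
    nlinarith
  refine Real.le_sqrt_of_sq_le ?_
  have hsB := Real.sq_sqrt hB0
  have hsA := Real.sq_sqrt hA0
  calc (Real.sqrt B + Real.sqrt A) ^ 2 = B + A + 2 * (Real.sqrt B * Real.sqrt A) := by
        rw [add_sq, hsB, hsA]; ring
    _ ≤ _ := by linarith

/-- The bound with separated error terms follows from the bound under one square root. Here
`d ≤ N (1 + x)` is the dimension of the symmetric subspace, `t = 1 / dB` and `x = k ^ 2 / dA`. -/
theorem sqrt_le_sqrt_add {d t N x ε y : ℝ} (hd : 0 ≤ d) (ht : 0 ≤ t) (hdN : d ≤ N * (1 + x))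
    (hε : 0 ≤ ε) (hN : 0 ≤ N) (hy0 : 0 ≤ y) (hy : y ^ 2 = x) (hQ : N * (t + 100 * ε) ≤ 4) :
    Real.sqrt (d * t + 100 * (x + d * ε + Real.sqrt (x * (d * t)))) ≤
      Real.sqrt (N * (t + 100 * ε)) + 102 * y := by
  have hdt0 : 0 ≤ d * t := by positivity
  set s := Real.sqrt (d * t) with hs
  have hs0 : 0 ≤ s := Real.sqrt_nonneg _
  have hs2 : s ^ 2 = d * t := Real.sq_sqrt hdt0
  have hx0 : 0 ≤ x := by rw [← hy]; positivity
  set Q := N * (t + 100 * ε) with hQdef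
  have hQ0 : 0 ≤ Q := by positivity
  set q := Real.sqrt Q with hq
  have hq0 : 0 ≤ q := Real.sqrt_nonneg _
  have hq2 : q ^ 2 = Q := Real.sq_sqrt hQ0
  have hqle : q ≤ 2 := Real.sqrt_le_iff.2 ⟨by norm_num, by linarith⟩
  have h1 : Real.sqrt (x * (d * t)) = y * s := by
    rw [← hy, Real.sqrt_mul (sq_nonneg y), Real.sqrt_sq hy0]
  have h2 : d * (t + 100 * ε) ≤ (q + 2 * y) ^ 2 := by
    have h3 : d * (t + 100 * ε) ≤ N * (1 + x) * (t + 100 * ε) :=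
      mul_le_mul_of_nonneg_right hdN (by positivity)
    have h4 : N * (1 + x) * (t + 100 * ε) = Q + Q * x := by rw [hQdef]; ring
    have h5 : Q * x ≤ 4 * x := mul_le_mul_of_nonneg_right hQ hx0
    have h6 : 0 ≤ q * y := by positivity
    nlinarith
  have hsq : s ≤ q + 2 * y := by
    refine Real.sqrt_le_iff.2 ⟨by positivity, le_trans ?_ h2⟩
    have : 0 ≤ d * (100 * ε) := by positivity
    linarith
  refine Real.sqrt_le_iff.2 ⟨by positivity, ?_⟩
  rw [h1]
  have h7 : y * s ≤ y * (q + 2 * y) := mul_le_mul_of_nonneg_left hsq hy0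
  have h8 : 0 ≤ y * q := by positivity
  nlinarith

theorem projMoment_zero_sub {α β : Type*} [Fintype α] [Fintype β] [Nonempty α]
    (b : OrthonormalBasis β ℂ (EuclideanSpace ℂ β)) (Ψ : PureState (α × β)) :
    projMoment 0 b (Ψ : EuclideanSpace ℂ (α × β)) - moment 0 (haar α) = 0 := by
  ext i j
  have h : ∑ z, (outcomeProb (b z) (Ψ : EuclideanSpace ℂ (α × β)) : ℂ) = 1 := by
    rw [← Complex.ofReal_sum]
    simp only [outcomeProb]
    rw [sum_norm_condState_sq, norm_eq_of_mem_sphere]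
    simp
  simp [projMoment, moment, tensorProj, Matrix.sum_apply, h]

theorem traceNorm_zero {n : Type*} [Fintype n] [DecidableEq n] :
    traceNorm (0 : Matrix n n ℂ) = 0 := by
  refine le_antisymm (traceNorm_le_of_forall fun W _ => ?_) (traceNorm_nonneg _)
  simp

theorem integral_traceNorm_le_two {α β : Type*} [Fintype α] [Fintype β] [Nonempty α]
    [DecidableEq α] {μ : Measure (PureState (α × β))} [IsProbabilityMeasure μ] (k : ℕ)
    (b : OrthonormalBasis β ℂ (EuclideanSpace ℂ β)) :
    ∫ Ψ : PureState (α × β), traceNorm (projMoment k b (Ψ : EuclideanSpace ℂ (α × β)) -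
      moment k (haar α)) ∂μ ≤ 2 := by
  have := integral_mono (integrable_traceNorm_projMoment_sub (k := k) b μ) (integrable_const 2)
    fun Ψ => traceNorm_projMoment_sub_le_two b Ψ
  simpa using this

/-- The average trace distance in the regime where the bound is not trivial. -/
theorem integral_traceNorm_le_sqrt {DA DB k : ℕ} (hA : 1 ≤ DA) (hB : 1 ≤ DB) (hk : 1 ≤ k)
    {ε : ℝ} {μ : Measure (PureState (Fin DA × Fin DB))} [IsProbabilityMeasure μ]
    (h : IsDesignRel (2 * k) ε μ) (b : OrthonormalBasis (Fin DB) ℂ (EuclideanSpace ℂ (Fin DB)))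
    (hx : (k : ℝ) ^ 2 / DA ≤ 1) (hR : (symDim DA k : ℝ) / DB ≤ 4) (hε1 : ε ≤ 1) :
    ∫ Ψ : PureState (Fin DA × Fin DB),
      traceNorm (projMoment k b (Ψ : EuclideanSpace ℂ (Fin DA × Fin DB)) -
        moment k (haar (Fin DA))) ∂μ ≤
      Real.sqrt ((symDim DA k : ℝ) / DB + 100 * ((k : ℝ) ^ 2 / DA + symDim DA k * ε +
        Real.sqrt ((k : ℝ) ^ 2 / DA * (symDim DA k / DB)))) := by
  have : Nonempty (Fin DA) := ⟨⟨0, hA⟩⟩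
  have : Nonempty (Fin DB) := ⟨⟨0, hB⟩⟩
  have hε := h.nonneg
  set c : ℝ := (DB : ℝ) ^ (k - 1) with hc
  have h1 := integral_sum_abs_sub_le hk h hε1 b
  have h2 := integral_traceNorm_sum_tensorProj_sub_le hk h hε1 b
  simp only [Fintype.card_fin, ← hc] at h1 h2
  have hi1 : Integrable (fun Ψ : PureState (Fin DA × Fin DB) =>
      ∑ z, |‖condState (b z) (Ψ : EuclideanSpace ℂ (Fin DA × Fin DB))‖ ^ 2 -
        c * ‖condState (b z) (Ψ : EuclideanSpace ℂ (Fin DA × Fin DB))‖ ^ (2 * k)|) μ :=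
    integrable_of_continuous (by fun_prop)
  have hi2 : Integrable (fun Ψ : PureState (Fin DA × Fin DB) => traceNorm ((c : ℂ) •
      ∑ z, tensorProj k (condState (b z) (Ψ : EuclideanSpace ℂ (Fin DA × Fin DB))) -
        moment k (haar (Fin DA)))) μ :=
    integrable_of_continuous (continuous_traceNorm_sum_tensorProj_sub b (c : ℂ) _)
  have h3 := integral_mono (integrable_traceNorm_projMoment_sub (k := k) b μ) (hi1.add hi2)
    fun Ψ => traceNorm_projMoment_sub_le b c Ψ
  have h4 := integral_add hi1 hi2
  simp only [Pi.add_apply] at h3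
  rw [h4] at h3
  refine h3.trans ((add_le_add h1 h2).trans ?_)
  have hAr : (1 : ℝ) ≤ DA := by exact_mod_cast hA
  have hBr : (1 : ℝ) ≤ DB := by exact_mod_cast hB
  have hkr : (1 : ℝ) ≤ k := by exact_mod_cast hk
  have hd : (DA : ℝ) ≤ symDim DA k := by exact_mod_cast le_symDim hA hk
  have hd0 : (0 : ℝ) < symDim DA k := by linarith
  have hkey : ((DB : ℝ)⁻¹) ≤ Real.sqrt ((k : ℝ) ^ 2 / DA * (symDim DA k * (DB : ℝ)⁻¹)) := by
    refine Real.le_sqrt_of_sq_le ?_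
    have hBi : (DB : ℝ)⁻¹ ≤ 1 := inv_le_one_of_one_le₀ hBr
    have hBi0 : 0 ≤ (DB : ℝ)⁻¹ := by positivity
    have h5 : 1 ≤ (k : ℝ) ^ 2 / DA * symDim DA k := by
      rw [div_mul_eq_mul_div, one_le_div (by linarith)]
      exact hd.trans (le_mul_of_one_le_left hd0.le (one_le_pow₀ hkr))
    calc ((DB : ℝ)⁻¹) ^ 2 ≤ 1 * (DB : ℝ)⁻¹ := by nlinarith
      _ ≤ ((k : ℝ) ^ 2 / DA * symDim DA k) * (DB : ℝ)⁻¹ := mul_le_mul_of_nonneg_right h5 hBi0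
      _ = _ := by ring
  have := sqrt_add_sqrt_le (d := symDim DA k) (t := (DB : ℝ)⁻¹) (a := momentRatio DA DB (2 * k))
    (x := (k : ℝ) ^ 2 / DA) (ε := ε) (hAr.trans hd) (by positivity)
    (by rwa [← div_eq_mul_inv]) (one_le_momentRatio hA hB _) (momentRatio_two_mul_le hA hB hx)
    (by positivity) hx hε (Real.sqrt_nonneg _) (Real.sq_sqrt (by positivity)) hkey
  simpa only [← div_eq_mul_inv] using this

end DeepTherm

theorem corollary1 :
    ∃ C : ℝ, 0 < C ∧
      ∀ (DA DB k : ℕ), 1 ≤ DA → 1 ≤ DB → ∀ (ε : ℝ)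
        (μ : Measure (DeepTherm.PureState (Fin DA × Fin DB))),
        IsProbabilityMeasure μ → DeepTherm.IsDesignRel (2 * k) ε μ →
        ∀ b : OrthonormalBasis (Fin DB) ℂ (EuclideanSpace ℂ (Fin DB)),
          Integrable (fun Ψ : DeepTherm.PureState (Fin DA × Fin DB) =>
            DeepTherm.traceNorm (DeepTherm.projMoment k b (Ψ : EuclideanSpace ℂ (Fin DA × Fin DB)) -
              DeepTherm.moment k (DeepTherm.haar (Fin DA)))) μ ∧
          ∫ Ψ : DeepTherm.PureState (Fin DA × Fin DB),
            DeepTherm.traceNorm (DeepTherm.projMoment k b (Ψ : EuclideanSpace ℂ (Fin DA × Fin DB)) -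
              DeepTherm.moment k (DeepTherm.haar (Fin DA))) ∂μ
            ≤ Real.sqrt ((DeepTherm.symDim DA k : ℝ) / DB +
                C * ((k : ℝ) ^ 2 / DA + DeepTherm.symDim DA k * ε +
                  Real.sqrt ((k : ℝ) ^ 2 / DA * (DeepTherm.symDim DA k / DB)))) ∧
          ∫ Ψ : DeepTherm.PureState (Fin DA × Fin DB),
            DeepTherm.traceNorm (DeepTherm.projMoment k b (Ψ : EuclideanSpace ℂ (Fin DA × Fin DB)) -
              DeepTherm.moment k (DeepTherm.haar (Fin DA))) ∂μ
            ≤ Real.sqrt ((DA : ℝ) ^ k / (k.factorial : ℝ) * (1 / DB + C * ε))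
              + C * (k / Real.sqrt DA) := by
  refine ⟨102, by norm_num, fun DA DB k hA hB ε μ hμ h b => ?_⟩
  have : Nonempty (Fin DA) := ⟨⟨0, hA⟩⟩
  have : Nonempty (Fin DB) := ⟨⟨0, hB⟩⟩
  refine ⟨DeepTherm.integrable_traceNorm_projMoment_sub b μ, ?_⟩
  have hε := h.nonneg
  have hAr : (1 : ℝ) ≤ DA := by exact_mod_cast hA
  have hBr : (1 : ℝ) ≤ DB := by exact_mod_cast hB
  have hd : (1 : ℝ) ≤ DeepTherm.symDim DA k := by exact_mod_cast DeepTherm.symDim_pos hA k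
  have h2 := DeepTherm.integral_traceNorm_le_two (μ := μ) k b
  set d : ℝ := ((DeepTherm.symDim DA k : ℕ) : ℝ) with hdef
  set x : ℝ := (k : ℝ) ^ 2 / DA with hxdef
  have hx0 : 0 ≤ x := by positivity
  set y : ℝ := k / Real.sqrt DA with hydef
  have hy0 : 0 ≤ y := by positivity
  have hy2 : y ^ 2 = x := by rw [hydef, div_pow, Real.sq_sqrt (by linarith)]
  set N : ℝ := (DA : ℝ) ^ k / (k.factorial : ℝ) with hNdef
  have hN0 : 0 ≤ N := by positivity
  have hdε : 0 ≤ d * ε := by positivity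
  have hR0 : 0 ≤ d / DB := by positivity
  have hr0 : 0 ≤ Real.sqrt (x * (d / DB)) := Real.sqrt_nonneg _
  have hDB0 : 0 ≤ 1 / (DB : ℝ) := by positivity
  have htwo : ∀ s : ℝ, 4 ≤ s → 2 ≤ Real.sqrt s := fun s hs =>
    Real.le_sqrt_of_sq_le (by linarith)
  rcases Nat.eq_zero_or_pos k with hk0 | hk
  · -- for `k = 0` both moment operators are the `1 × 1` identity
    have hz : ∫ Ψ : DeepTherm.PureState (Fin DA × Fin DB),
        DeepTherm.traceNorm (DeepTherm.projMoment k b (Ψ : EuclideanSpace ℂ (Fin DA × Fin DB)) -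
          DeepTherm.moment k (DeepTherm.haar (Fin DA))) ∂μ = 0 := by
      subst hk0
      simp_rw [DeepTherm.projMoment_zero_sub, DeepTherm.traceNorm_zero]
      simp
    rw [hz]
    exact ⟨Real.sqrt_nonneg _, by positivity⟩
  by_cases hx : x ≤ 1
  · -- the first bound with the constant `100`; it is trivial unless `d / DB ≤ 4` and `ε ≤ 1`
    have hmain : ∫ Ψ : DeepTherm.PureState (Fin DA × Fin DB),
        DeepTherm.traceNorm (DeepTherm.projMoment k b (Ψ : EuclideanSpace ℂ (Fin DA × Fin DB)) -
          DeepTherm.moment k (DeepTherm.haar (Fin DA))) ∂μ ≤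
        Real.sqrt (d / DB + 100 * (x + d * ε + Real.sqrt (x * (d / DB)))) := by
      by_cases hR : d / DB ≤ 4
      · by_cases hε1 : ε ≤ 1
        · exact DeepTherm.integral_traceNorm_le_sqrt hA hB hk h b hx hR hε1
        · push Not at hε1
          exact h2.trans (htwo _ (by nlinarith))
      · push Not at hR
        exact h2.trans (htwo _ (by linarith))
    refine ⟨hmain.trans (Real.sqrt_le_sqrt (by linarith)), ?_⟩
    have hmono : Real.sqrt (N * (1 / DB + 100 * ε)) ≤ Real.sqrt (N * (1 / DB + 102 * ε)) :=
      Real.sqrt_le_sqrt (mul_le_mul_of_nonneg_left (by linarith) hN0)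
    by_cases hQ : N * (1 / DB + 100 * ε) ≤ 4
    · have hfin := DeepTherm.sqrt_le_sqrt_add (d := d) (t := 1 / (DB : ℝ)) (by linarith) hDB0
        (DeepTherm.symDim_le_pow_div_factorial hA hx) hε hN0 hy0 hy2 hQ
      rw [mul_one_div] at hfin
      exact hmain.trans (hfin.trans (add_le_add_left hmono _))
    · push Not at hQ
      have := htwo _ hQ.le
      linarith
  · push Not at hx
    have hy1 : 1 ≤ y := by
      rw [← hy2] at hx
      nlinarith
    exact ⟨h2.trans (htwo _ (by linarith)),
      by linarith [Real.sqrt_nonneg (N * (1 / DB + 102 * ε))]⟩
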